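/- Let $M$ be a smooth $n$-dimensional manifold without boundary, let $J\subseteq\mathbb R$ be an interval, and let $g(\tau)$, $\tau\in J$, be a family of Riemannian metrics on $M$ that is smooth on $M\times J$ and solves the backward Ricci flow $\frac{\partial g}{\partial\tau}=2\,\mathrm{Ric}(g(\tau))$. Let $0\le\tau_1<\tau_2$ with $[\tau_1,\tau_2]\subseteq J$. For a smooth curve $\gamma:[\tau_1,\tau_2]\to M$ put $$\mathcal L(\gamma)=\int_{\tau_1}^{\tau_2}\sqrt\tau\,\bigl(R(\gamma(\tau))+|\dot\gamma(\tau)|^2\bigr)\,d\tau ,$$ where the scalar curvature $R$ and the norm are those of $g(\tau)$. **Theorem 2.1 (first variation of the $\mathcal L$-length).** Let $\varepsilon>0$, let $\tilde\gamma:(-\varepsilon,\varepsilon)\times[\tau_1,\tau_2]\to M$, $(s,\tau)\mapsto\gamma_s(\tau)$, be a smooth family of curves, and put $\gamma=\gamma_0$, $X=\frac{\partial\tilde\gamma}{\partial\tau}\big|_{s=0}=\dot\gamma$ and $Y=\frac{\partial\tilde\gamma}{\partial s}\big|_{s=0}$. Then the integrals below and those defining $\mathcal L(\gamma_s)$, $|s|<\varepsilon$,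 converge absolutely, the function $s\mapsto\mathcal L(\gamma_s)$ is differentiable at $s=0$, and its derivative $\delta_Y\mathcal L$ there is $$\delta_Y\mathcal L=2\sqrt\tau\,\langle X,Y\rangle\Big|_{\tau_1}^{\tau_2}+\int_{\tau_1}^{\tau_2}\sqrt\tau\,\Bigl\langle Y,\ \nabla R-2\nabla_XX-4\,\mathrm{Ric}(X,\cdot)-\frac1\tau X\Bigr\rangle\,d\tau .$$ Here $\langle\cdot,\cdot\rangle$, $\nabla$ (the gradient, and the Levi-Civita covariant derivative along $\gamma$), $\mathrm{Ric}$ and $R$ at time $\tau$ are those of $g(\tau)$, and $\mathrm{Ric}(X,\cdot)$ is regarded as a tangent vector by means of $g(\tau)$. -/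

import Mathlib

open Set MeasureTheory
open scoped Manifold ContDiff

noncomputable section

/-- Smooth Riemannian metrics on an `n`-dimensional manifold `M` (without boundary). -/
abbrev SmoothMetric (n : ℕ) (M : Type*) [TopologicalSpace M]
    [ChartedSpace (EuclideanSpace ℝ (Fin n)) M] [IsManifold (𝓡 n) ∞ M] :=
  Bundle.ContMDiffRiemannianMetric (𝓡 n) ∞ (EuclideanSpace ℝ (Fin n))
    (TangentSpace (𝓡 n) : M → Type _)

namespace SmoothMetric

variable {n : ℕ}

/-- The `i`-th standard basis vector of `ℝⁿ`. -/
def stdVec (i : Fin n) : EuclideanSpace ℝ (Fin n) := EuclideanSpace.single i 1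

/-- The partial derivative `∂ᵢ f` of a function on `ℝⁿ`. -/
def partialDeriv (i : Fin n) (f : EuclideanSpace ℝ (Fin n) → ℝ)
    (z : EuclideanSpace ℝ (Fin n)) : ℝ :=
  fderiv ℝ f z (stdVec i)

variable {M : Type*} [TopologicalSpace M] [ChartedSpace (EuclideanSpace ℝ (Fin n)) M]

/-- The coordinate vector field `∂ᵢ` of the preferred chart at `x₀`, at the point with
coordinates `z`. -/
def coordVec (x₀ : M) (i : Fin n) (z : EuclideanSpace ℝ (Fin n)) :
    TangentSpace (𝓡 n) ((extChartAt (𝓡 n) x₀).symm z) :=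
  mfderiv 𝓘(ℝ, EuclideanSpace ℝ (Fin n)) (𝓡 n) (extChartAt (𝓡 n) x₀).symm z (stdVec i)

variable [IsManifold (𝓡 n) ∞ M] (g : SmoothMetric n M)

/-- The matrix `g_{ij} = g(∂ᵢ, ∂ⱼ)` in the chart at `x₀`, as a function of the coordinates. -/
def metricCoeff (x₀ : M) (z : EuclideanSpace ℝ (Fin n)) : Matrix (Fin n) (Fin n) ℝ :=
  Matrix.of fun i j => g.inner ((extChartAt (𝓡 n) x₀).symm z) (coordVec x₀ i z) (coordVec x₀ j z)

/-- The Christoffel symbol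
`Γᵏᵢⱼ = ½ ∑ₗ gᵏˡ (∂ᵢ g_{jl} + ∂ⱼ g_{il} - ∂ₗ g_{ij})` of the Levi-Civita connection in the chart
at `x₀`. -/
def christoffel (x₀ : M) (k i j : Fin n) (z : EuclideanSpace ℝ (Fin n)) : ℝ :=
  (1 / 2) * ∑ l, (metricCoeff g x₀ z)⁻¹ k l *
    (partialDeriv i (fun y => metricCoeff g x₀ y j l) z
      + partialDeriv j (fun y => metricCoeff g x₀ y i l) z
      - partialDeriv l (fun y => metricCoeff g x₀ y i j) z)

/-- The component `l` of `R(∂ᵢ, ∂ⱼ) ∂ₖ = ∇ᵢ ∇ⱼ ∂ₖ - ∇ⱼ ∇ᵢ ∂ₖ` in the chart at `x₀`. -/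
def riemannCoeff (x₀ : M) (l i j k : Fin n) (z : EuclideanSpace ℝ (Fin n)) : ℝ :=
  partialDeriv i (christoffel g x₀ l j k) z - partialDeriv j (christoffel g x₀ l i k) z
    + ∑ p, (christoffel g x₀ l i p z * christoffel g x₀ p j k z
      - christoffel g x₀ l j p z * christoffel g x₀ p i k z)

/-- The component `Ric(∂ⱼ, ∂ₖ)`, the trace of `V ↦ R(V, ∂ⱼ) ∂ₖ`, in the chart at `x₀`. -/
def ricciCoeff (x₀ : M) (z : EuclideanSpace ℝ (Fin n)) : Matrix (Fin n) (Fin n) ℝ :=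
  Matrix.of fun j k => ∑ i, riemannCoeff g x₀ i i j k z

/-- The Ricci tensor at `x`. The tangent space at `x` is identified with `ℝⁿ` by means of the
preferred chart at `x`, so that its components are the ones in that chart. -/
def ricci (x : M) : TangentSpace (𝓡 n) x →ₗ[ℝ] TangentSpace (𝓡 n) x →ₗ[ℝ] ℝ :=
  Matrix.toBilin (EuclideanSpace.basisFun (Fin n) ℝ).toBasis
    (ricciCoeff g x (extChartAt (𝓡 n) x x))

/-- The scalar curvature `R = ∑ gʲᵏ Ric_{jk}`. -/
def scalarCurvature (x : M) : ℝ :=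
  ∑ j, ∑ k, (metricCoeff g x (extChartAt (𝓡 n) x x))⁻¹ j k *
    ricciCoeff g x (extChartAt (𝓡 n) x x) j k

/-- The tangent vector `ℓ^♯` with `g(ℓ^♯, v) = ℓ v` for all `v`, that is
`(ℓ^♯)ⁱ = ∑ⱼ gⁱʲ ℓ(∂ⱼ)`. -/
def sharp (x : M) (ℓ : TangentSpace (𝓡 n) x →ₗ[ℝ] ℝ) : TangentSpace (𝓡 n) x :=
  WithLp.toLp 2 fun i =>
    ∑ j, (Matrix.of fun a b => g.inner x (stdVec a) (stdVec b))⁻¹ i j * ℓ (stdVec j)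

/-- The gradient of a function. -/
def gradient (f : M → ℝ) (x : M) : TangentSpace (𝓡 n) x :=
  sharp g x (mvfderiv (𝓡 n) f x : TangentSpace (𝓡 n) x →L[ℝ] ℝ)

/-- The tangent vector `Ric(v, ·)`, with its index raised by the metric. -/
def ricciVec (x : M) (v : TangentSpace (𝓡 n) x) : TangentSpace (𝓡 n) x :=
  sharp g x (ricci g x v)

/-- The velocity of a curve `c` on the time interval `J` (one-sided at endpoints in `J`). -/
def velocity (J : Set ℝ) (c : ℝ → M) (τ : ℝ) : TangentSpace (𝓡 n) (c τ) :=
  mfderivWithin 𝓘(ℝ, ℝ) (𝓡 n) c J τ (1 : ℝ)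

/-- The covariant derivative `∇_{ċ} V` at time `τ` of a vector field `V` along a curve `c` on the
time interval `J`: in the chart at `c τ`, it has the components
`dVᵏ/dτ + ∑ᵢⱼ Γᵏᵢⱼ ċⁱ Vʲ`. -/
def covDerivAlong (J : Set ℝ) (c : ℝ → M) (V : ∀ σ, TangentSpace (𝓡 n) (c σ)) (τ : ℝ) :
    TangentSpace (𝓡 n) (c τ) :=
  let components : ℝ → EuclideanSpace ℝ (Fin n) := fun σ =>
    mfderiv (𝓡 n) 𝓘(ℝ, EuclideanSpace ℝ (Fin n)) (extChartAt (𝓡 n) (c τ)) (c σ) (V σ)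
  let speed : EuclideanSpace ℝ (Fin n) :=
    derivWithin (fun σ => extChartAt (𝓡 n) (c τ) (c σ)) J τ
  derivWithin components J τ +
    WithLp.toLp 2 fun k => ∑ i, ∑ j,
      christoffel g (c τ) k i j (extChartAt (𝓡 n) (c τ) (c τ)) * speed i * components τ j

end SmoothMetric

open SmoothMetric

variable {n : ℕ} {M : Type*} [TopologicalSpace M] [ChartedSpace (EuclideanSpace ℝ (Fin n)) M]
  [IsManifold (𝓡 n) ∞ M]

/-- `g(τ)`, `τ ∈ J`, is a smooth solution of the backward Ricci flow `∂g/∂τ = 2 Ric(g)`. -/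
structure IsBackwardRicciFlow (g : ℝ → SmoothMetric n M) (J : Set ℝ) : Prop where
  /-- the metric is smooth in space and time jointly -/
  smooth : ContMDiffOn ((𝓡 n).prod 𝓘(ℝ, ℝ))
    ((𝓡 n).prod 𝓘(ℝ, EuclideanSpace ℝ (Fin n) →L[ℝ] EuclideanSpace ℝ (Fin n) →L[ℝ] ℝ)) ∞
    (fun p : M × ℝ => Bundle.TotalSpace.mk'
      (EuclideanSpace ℝ (Fin n) →L[ℝ] EuclideanSpace ℝ (Fin n) →L[ℝ] ℝ)
      (E := fun x : M => TangentSpace (𝓡 n) x →L[ℝ] TangentSpace (𝓡 n) x →L[ℝ] ℝ)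
      p.1 ((g p.2).inner p.1))
    (univ ×ˢ J)
  flow : ∀ τ ∈ J, ∀ (x : M) (v w : TangentSpace (𝓡 n) x),
    HasDerivWithinAt (fun σ => (g σ).inner x v w) (2 * ricci (g τ) x v w) J τ

/-- The integrand `√τ (R(c(τ)) + |ċ(τ)|²)` of the `𝓛`-length of a curve `c : [τ₁, τ₂] → M`, with
curvature and norm taken with respect to `g(τ)`. -/
def LIntegrand (g : ℝ → SmoothMetric n M) (τ₁ τ₂ : ℝ) (c : ℝ → M) (τ : ℝ) : ℝ :=
  √τ * (scalarCurvature (g τ) (c τ) +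
    (g τ).inner (c τ) (velocity (Icc τ₁ τ₂) c τ) (velocity (Icc τ₁ τ₂) c τ))

/-- Perelman's `𝓛`-length of a curve `c : [τ₁, τ₂] → M`. -/
def LLength (g : ℝ → SmoothMetric n M) (τ₁ τ₂ : ℝ) (c : ℝ → M) : ℝ :=
  ∫ τ in τ₁..τ₂, LIntegrand g τ₁ τ₂ c τ

/-- The variation field `Y = ∂γ/∂s` at `s = 0` of a family of curves `γ s τ`. -/
def variationField (γ : ℝ → ℝ → M) (τ : ℝ) : TangentSpace (𝓡 n) (γ 0 τ) :=
  mfderiv 𝓘(ℝ, ℝ) (𝓡 n) (fun s => γ s τ) 0 (1 : ℝ)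

/-- The vector field `∇R - 2 ∇_X X - 4 Ric(X, ·) - X / τ` along a curve `c : [τ₁, τ₂] → M` with
velocity `X`, with respect to `g(τ)`. -/
def eulerLagrangeField (g : ℝ → SmoothMetric n M) (τ₁ τ₂ : ℝ) (c : ℝ → M) (τ : ℝ) :
    TangentSpace (𝓡 n) (c τ) :=
  gradient (g τ) (scalarCurvature (g τ)) (c τ)
    - (2 : ℝ) • covDerivAlong (g τ) (Icc τ₁ τ₂) c (velocity (Icc τ₁ τ₂) c) τ
    - (4 : ℝ) • ricciVec (g τ) (c τ) (velocity (Icc τ₁ τ₂) c τ)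
    - (1 / τ) • velocity (Icc τ₁ τ₂) c τ

end

open Filter
open scoped Topology

noncomputable section

/-! Calculus lemmas -/

/-! Write `H(s, τ) = R(γ_s(τ)) + |∂γ_s/∂τ|²` and `q(τ) = ⟨X, Y⟩`. The heart is the pointwise
identity `∂_s H = ⟨Y, ∇R - 2∇_X X - 4 Ric(X, ·)⟩ + 2 dq/dτ` at `s = 0` and interior `τ`
(`hasDerivAt_energyDensity`). Invariantly, `∂_s |X|² = 2⟨∇_Y X, X⟩ = 2⟨∇_X Y, X⟩`, while `dq/dτ =
⟨∇_X X, Y⟩ + ⟨X, ∇_X Y⟩ + 2 Ric(X, Y)`, the last term coming from the motion of the metric. The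
proof runs this in one fixed chart: symmetry of second derivatives replaces `∇_Y X = ∇_X Y`, and
Koszul's formula (`chartMetric_christoffel`) replaces metric compatibility.

It remains to multiply by `√τ` and integrate. Since `√τ (q/τ + 2q') = (2√τ q)'`, the total
derivative yields the boundary terms and the `-X/τ` term (`integral_deriv_sqrt_mul`).
Differentiation under the integral (`hasDerivAt_integral_weight_mul`) needs `H` smooth up to the
endpoints.

Curvature is defined at each point through the chart centred there, so its smoothness is not
evident. The flow equation supplies it: `Ric` is half the time derivative of the metric, which is
tensorial and smooth in any fixed chart (`scalarCurvature_eq_metricTrace`). No transformation law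
for Christoffel symbols or curvature is needed. -/

theorem HasFDerivAt.hasDerivAt_comp {W G : Type*} [NormedAddCommGroup W] [NormedSpace ℝ W]
    [NormedAddCommGroup G] [NormedSpace ℝ G] {F : W → G} {F' : W →L[ℝ] G} {c : ℝ → W} {c' : W}
    {t : ℝ} (hF : HasFDerivAt F F' (c t)) (hc : HasDerivAt c c' t) :
    HasDerivAt (fun r => F (c r)) (F' c') t :=
  hF.comp_hasDerivAt t hc

theorem HasFDerivAt.hasDerivAt_bilin {W E : Type*} [NormedAddCommGroup W] [NormedSpace ℝ W]
    [NormedAddCommGroup E] [NormedSpace ℝ E] {F : W → E →L[ℝ] E →L[ℝ] ℝ}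
    {F' : W →L[ℝ] E →L[ℝ] E →L[ℝ] ℝ} {q : W} {c : ℝ → W} {c' : W} {v w : ℝ → E} {v' w' : E} {t : ℝ}
    (hF : HasFDerivAt F F' q) (hc : HasDerivAt c c' t) (hq : c t = q)
    (hv : HasDerivAt v v' t) (hw : HasDerivAt w w' t) :
    HasDerivAt (fun r => F (c r) (v r) (w r))
      (F' c' (v t) (w t) + F q v' (w t) + F q (v t) w') t := by
  subst hq
  have hFc : HasDerivAt (fun r => F (c r)) (F' c') t :=
    HasFDerivAt.hasDerivAt_comp (F := F) (F' := F') hF hc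
  have h := (hFc.clm_apply hv).clm_apply hw
  simpa [add_apply, add_assoc] using h

theorem HasFDerivAt.partial_fst {W G : Type*} [NormedAddCommGroup W] [NormedSpace ℝ W]
    [NormedAddCommGroup G] [NormedSpace ℝ G] {F : W × ℝ → G} {F' : W × ℝ →L[ℝ] G} {z : W} {t : ℝ}
    (hF : HasFDerivAt F F' (z, t)) :
    HasFDerivAt (fun y => F (y, t)) (F'.comp (ContinuousLinearMap.inl ℝ W ℝ)) z :=
  HasFDerivAt.comp (g := F) (g' := F') z hF (hasFDerivAt_prodMk_left z t)

/-- One product rule serves both `∂_s |X|²` and `∂_τ ⟨X, Y⟩`: `c` is a coordinate line in the `(s,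
τ)` plane, `a` and `b` are coordinate directions. -/
theorem hasDerivAt_bilin_fderiv_comp {E : Type*} [NormedAddCommGroup E] [NormedSpace ℝ E]
    {F : E × ℝ → E →L[ℝ] E →L[ℝ] ℝ} {F' : E × ℝ →L[ℝ] E →L[ℝ] E →L[ℝ] ℝ} {u : ℝ × ℝ → E}
    {c : ℝ → ℝ × ℝ} {t : ℝ} {d : ℝ × ℝ} (hu : ContDiffAt ℝ ∞ u (c t))
    (hF : HasFDerivAt F F' (u (c t), (c t).2)) (hc : HasDerivAt c d t) (a b : ℝ × ℝ) :
    HasDerivAt (fun r => F (u (c r), (c r).2) (fderiv ℝ u (c r) a) (fderiv ℝ u (c r) b))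
      (F' (fderiv ℝ u (c t) d, d.2) (fderiv ℝ u (c t) a) (fderiv ℝ u (c t) b)
        + F (u (c t), (c t).2) (fderiv ℝ (fderiv ℝ u) (c t) d a) (fderiv ℝ u (c t) b)
        + F (u (c t), (c t).2) (fderiv ℝ u (c t) a) (fderiv ℝ (fderiv ℝ u) (c t) d b)) t := by
  have hU : ∀ e : ℝ × ℝ, HasDerivAt (fun r => fderiv ℝ u (c r) e)
      (fderiv ℝ (fderiv ℝ u) (c t) d e) t := fun e => by
    have h := (((hu.fderiv_right (m := ∞) (by simp)).differentiableAt
      (by simp)).hasFDerivAt.comp_hasDerivAt t hc).clm_apply (hasDerivAt_const t e)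
    simpa using h
  have hsnd : HasDerivAt (fun r => (c r).2) d.2 t :=
    (hasFDerivAt_snd (𝕜 := ℝ) (E := ℝ) (F := ℝ) (p := c t)).comp_hasDerivAt t hc
  have hpair : HasDerivAt (fun r => (u (c r), (c r).2)) (fderiv ℝ u (c t) d, d.2) t :=
    ((hu.differentiableAt (by simp)).hasFDerivAt.comp_hasDerivAt t hc).prodMk hsnd
  exact hF.hasDerivAt_bilin hpair rfl (hU a) (hU b)

section

variable {a b ε : ℝ} {w : ℝ → ℝ} {H : ℝ × ℝ → ℝ}

theorem intervalIntegrable_weight_mul_slice (hab : a ≤ b) (hw : Continuous w)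
    (hH : ContDiffOn ℝ ∞ H (Ioo (-ε) ε ×ˢ Icc a b)) {s : ℝ} (hs : s ∈ Ioo (-ε) ε) :
    IntervalIntegrable (fun τ => w τ * H (s, τ)) volume a b := by
  refine ContinuousOn.intervalIntegrable ?_
  rw [uIcc_of_le hab]
  exact hw.continuousOn.mul
    (hH.continuousOn.comp (by fun_prop) fun τ hτ => ⟨hs, hτ⟩)

/-- Differentiation of a weighted integral of a smooth function under the integral sign. -/
theorem hasDerivAt_integral_weight_mul (hab : a < b) (hε : 0 < ε) (hw : Continuous w)
    (hH : ContDiffOn ℝ ∞ H (Ioo (-ε) ε ×ˢ Icc a b)) :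
    IntervalIntegrable (fun τ => w τ * deriv (fun s => H (s, τ)) 0) volume a b ∧
    HasDerivAt (fun s => ∫ τ in a..b, w τ * H (s, τ))
      (∫ τ in a..b, w τ * deriv (fun s => H (s, τ)) 0) 0 := by
  have hD : UniqueDiffOn ℝ (Ioo (-ε) ε ×ˢ Icc a b) :=
    isOpen_Ioo.uniqueDiffOn.prod (uniqueDiffOn_Icc hab)
  set H' : ℝ × ℝ → ℝ := fun q => fderivWithin ℝ H (Ioo (-ε) ε ×ˢ Icc a b) q (1, 0) with hH'
  have hH'c : ContinuousOn H' (Ioo (-ε) ε ×ˢ Icc a b) :=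
    (hH.continuousOn_fderivWithin hD (by simp)).clm_apply continuousOn_const
  have hderiv : ∀ s ∈ Ioo (-ε) ε, ∀ τ ∈ Icc a b,
      HasDerivAt (fun r => H (r, τ)) (H' (s, τ)) s := fun s hs τ hτ =>
    (HasFDerivWithinAt.comp_hasDerivWithinAt (t := Ioo (-ε) ε ×ˢ Icc a b)
      (f := fun r : ℝ => (r, τ)) s
      (hH.differentiableOn (by simp) (s, τ) ⟨hs, hτ⟩).hasFDerivWithinAt
      ((hasDerivWithinAt_id s (Ioo (-ε) ε)).prodMk (hasDerivWithinAt_const s _ τ))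
      (fun r hr => ⟨hr, hτ⟩)).hasDerivAt (isOpen_Ioo.mem_nhds hs)
  have h0 : (0 : ℝ) ∈ Ioo (-ε) ε := ⟨by linarith, hε⟩
  -- Shrinking to a compact `s`-interval makes the `s`-derivative bounded, so a constant dominates.
  have hsub : Icc (-(ε / 2)) (ε / 2) ⊆ Ioo (-ε) ε := fun s hs =>
    ⟨by linarith [hs.1], by linarith [hs.2]⟩
  obtain ⟨C, hC⟩ := (isCompact_Icc.prod isCompact_Icc).exists_bound_of_continuousOn
    (f := fun q : ℝ × ℝ => w q.2 * H' q) (s := Icc (-(ε / 2)) (ε / 2) ×ˢ Icc a b)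
    ((hw.comp continuous_snd).continuousOn.mul (hH'c.mono (prod_mono_left hsub)))
  have hIoc : ∀ τ ∈ uIoc a b, τ ∈ Icc a b := fun τ hτ => by
    rw [uIoc_of_le hab.le] at hτ
    exact Ioc_subset_Icc_self hτ
  have hmeas : ∀ f : ℝ → ℝ, ContinuousOn f (Icc a b) →
      AEStronglyMeasurable f (volume.restrict (uIoc a b)) := fun f hf => by
    rw [uIoc_of_le hab.le]
    exact (hf.mono Ioc_subset_Icc_self).aestronglyMeasurable measurableSet_Ioc
  have key := intervalIntegral.hasDerivAt_integral_of_dominated_loc_of_deriv_le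
    (μ := volume) (a := a) (b := b) (F := fun s τ => w τ * H (s, τ))
    (F' := fun s τ => w τ * H' (s, τ)) (x₀ := 0) (s := Icc (-(ε / 2)) (ε / 2))
    (bound := fun _ => C) (Icc_mem_nhds (by linarith) (by linarith))
    (by
      filter_upwards [isOpen_Ioo.mem_nhds h0] with s hs
      exact hmeas _ (hw.continuousOn.mul
        (hH.continuousOn.comp (by fun_prop) fun τ hτ => ⟨hs, hτ⟩)))
    (intervalIntegrable_weight_mul_slice hab.le hw hH h0)
    (hmeas _ (hw.continuousOn.mul (hH'c.comp (by fun_prop) fun τ hτ => ⟨h0, hτ⟩)))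
    (.of_forall fun τ hτ s hs => hC (s, τ) ⟨hs, hIoc τ hτ⟩)
    intervalIntegrable_const
    (.of_forall fun τ hτ s hs => (hderiv s (hsub hs) τ (hIoc τ hτ)).const_mul (w τ))
  have heq : ∀ τ ∈ Icc a b, w τ * H' (0, τ) = w τ * deriv (fun s => H (s, τ)) 0 := fun τ hτ => by
    rw [(hderiv 0 h0 τ hτ).deriv]
  refine ⟨(intervalIntegrable_congr fun τ hτ => heq τ (hIoc τ hτ)).1 key.1, ?_⟩
  rw [← intervalIntegral.integral_congr (f := fun τ => w τ * H' (0, τ)) fun τ hτ =>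
    heq τ (by rwa [uIcc_of_le hab.le] at hτ)]
  exact key.2

/-- For `a = 0` the primitive `2√τ q` is only continuous at the left end; the form of the
fundamental theorem used needs no more there, given that `τ^(-1/2)` is integrable. -/
theorem integral_deriv_sqrt_mul {q : ℝ → ℝ} (ha : 0 ≤ a) (hab : a < b)
    (hq : ContDiffOn ℝ ∞ q (Icc a b)) :
    IntervalIntegrable (fun τ => √τ * (1 / τ * q τ + 2 * deriv q τ)) volume a b ∧
    ∫ τ in a..b, √τ * (1 / τ * q τ + 2 * deriv q τ) = 2 * √b * q b - 2 * √a * q a := by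
  have hint : IntervalIntegrable (fun τ => √τ * (1 / τ * q τ + 2 * deriv q τ)) volume a b := by
    have h1 : IntervalIntegrable (fun τ : ℝ => τ ^ (-(1 / 2) : ℝ) * q τ) volume a b :=
      (intervalIntegral.intervalIntegrable_rpow' (by norm_num)).mul_continuousOn
        (by rw [uIcc_of_le hab.le]; exact hq.continuousOn)
    have h2 : IntervalIntegrable (fun τ : ℝ => √τ * (2 * derivWithin q (Icc a b) τ))
        volume a b := by
      refine ContinuousOn.intervalIntegrable ?_
      rw [uIcc_of_le hab.le]
      exact Real.continuous_sqrt.continuousOn.mul (continuousOn_const.mul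
        (hq.continuousOn_derivWithin (uniqueDiffOn_Icc hab) (by simp)))
    -- The comparison is made on the open interval: at the endpoints the two-sided `deriv q` is
    -- uncontrolled, and `1 / τ` is `0` at `τ = 0`.
    refine (h1.add h2).congr_uIoo fun τ hτ => ?_
    rw [uIoo_of_le hab.le] at hτ
    have hpos : 0 < τ := ha.trans_lt hτ.1
    have hs : √τ * (1 / τ) = τ ^ (-(1 / 2) : ℝ) := by
      rw [Real.rpow_neg hpos.le, ← Real.sqrt_eq_rpow, mul_one_div, Real.sqrt_div_self']
      simp
    beta_reduce
    rw [derivWithin_of_mem_nhds (Icc_mem_nhds hτ.1 hτ.2), ← hs]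
    ring
  refine ⟨hint, intervalIntegral.integral_eq_sub_of_hasDerivAt_of_le hab.le
    (f := fun τ => 2 * √τ * q τ) ?_ (fun τ hτ => ?_) hint⟩
  · exact (continuousOn_const.mul Real.continuous_sqrt.continuousOn).mul hq.continuousOn
  · have hpos : 0 < τ := ha.trans_lt hτ.1
    have hd : HasDerivAt q (deriv q τ) τ :=
      ((hq.contDiffAt (Icc_mem_nhds hτ.1 hτ.2)).differentiableAt (by simp)).hasDerivAt
    refine (((Real.hasDerivAt_sqrt hpos.ne').const_mul 2).mul hd).congr_deriv ?_
    have hne : √τ ≠ 0 := (Real.sqrt_pos.2 hpos).ne'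
    have hsq : √τ * √τ = τ := Real.mul_self_sqrt hpos.le
    have h1 : √τ * (1 / τ) = 1 / √τ := by
      field_simp
      rw [sq, hsq]
    rw [mul_add, ← mul_assoc, h1]
    field_simp

end

/-! Metrics in a chart -/

namespace SmoothMetric

variable {n : ℕ} {M : Type*} [TopologicalSpace M] [ChartedSpace (EuclideanSpace ℝ (Fin n)) M]

/-- The differential of the inverse of the preferred chart at `p`, at the point `z`. -/
def chartSymmDeriv (p : M) (z : EuclideanSpace ℝ (Fin n)) :
    EuclideanSpace ℝ (Fin n) →L[ℝ] TangentSpace (𝓡 n) ((extChartAt (𝓡 n) p).symm z) :=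
  mfderiv 𝓘(ℝ, EuclideanSpace ℝ (Fin n)) (𝓡 n) (extChartAt (𝓡 n) p).symm z

/-- The differential of the preferred chart at `p`, at the point `x`. -/
def chartDeriv (p x : M) : TangentSpace (𝓡 n) x →L[ℝ] EuclideanSpace ℝ (Fin n) :=
  mfderiv (𝓡 n) 𝓘(ℝ, EuclideanSpace ℝ (Fin n)) (extChartAt (𝓡 n) p) x

variable [IsManifold (𝓡 n) ∞ M]

instance : IsManifold (𝓡 n) 1 M := IsManifold.of_le (n := ∞) (by simp)

theorem chartDeriv_chartSymmDeriv {p : M} {z : EuclideanSpace ℝ (Fin n)}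
    (hz : z ∈ (extChartAt (𝓡 n) p).target) (a : EuclideanSpace ℝ (Fin n)) :
    chartDeriv p ((extChartAt (𝓡 n) p).symm z) (chartSymmDeriv p z a) = a := by
  have h := mfderiv_extChartAt_comp_mfderivWithin_extChartAt_symm (I := 𝓡 n) hz
  rw [ModelWithCorners.range_eq_univ, mfderivWithin_univ] at h
  exact DFunLike.congr_fun h a

theorem chartSymmDeriv_chartDeriv {p : M} {z : EuclideanSpace ℝ (Fin n)}
    (hz : z ∈ (extChartAt (𝓡 n) p).target)
    (v : TangentSpace (𝓡 n) ((extChartAt (𝓡 n) p).symm z)) :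
    chartSymmDeriv p z (chartDeriv p ((extChartAt (𝓡 n) p).symm z) v) = v := by
  have h := mfderivWithin_extChartAt_symm_comp_mfderiv_extChartAt (I := 𝓡 n) hz
  rw [ModelWithCorners.range_eq_univ, mfderivWithin_univ] at h
  exact DFunLike.congr_fun h v

/-- The tangent space at `p` is modelled on `ℝⁿ` by the chart at `p` itself, so vectors at `p` are
their own components there. This connects the coordinate definitions with computations in the chart.
-/
theorem chartDeriv_self (p : M) (v : TangentSpace (𝓡 n) p) : chartDeriv p p v = v := by
  rw [chartDeriv, mfderiv_extChartAt_self]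
  rfl

/-- The metric in the preferred chart at `p`. -/
def chartMetric (g : SmoothMetric n M) (p : M) (z : EuclideanSpace ℝ (Fin n)) :
    EuclideanSpace ℝ (Fin n) →L[ℝ] EuclideanSpace ℝ (Fin n) →L[ℝ] ℝ :=
  LinearMap.toContinuousLinearMap <| LinearMap.toContinuousLinearMap.toLinearMap ∘ₗ
    LinearMap.mk₂ ℝ (fun a b => g.inner ((extChartAt (𝓡 n) p).symm z)
      (chartSymmDeriv p z a) (chartSymmDeriv p z b))
      (by intros; simp only [map_add, add_apply])
      (by intros; simp only [map_smul, smul_apply])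
      (by intros; simp only [map_add]) (by intros; simp only [map_smul])

variable (g : SmoothMetric n M)

theorem chartMetric_apply (p : M) (z a b : EuclideanSpace ℝ (Fin n)) :
    chartMetric g p z a b = g.inner ((extChartAt (𝓡 n) p).symm z)
      (chartSymmDeriv p z a) (chartSymmDeriv p z b) := rfl

theorem inner_eq_chartMetric {p x : M} (hx : x ∈ (extChartAt (𝓡 n) p).source)
    (v w : TangentSpace (𝓡 n) x) :
    g.inner x v w =
      chartMetric g p (extChartAt (𝓡 n) p x) (chartDeriv p x v) (chartDeriv p x w) := by
  obtain ⟨z, hz, rfl⟩ : ∃ z ∈ (extChartAt (𝓡 n) p).target, (extChartAt (𝓡 n) p).symm z = x :=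
    ⟨_, (extChartAt (𝓡 n) p).map_source hx, (extChartAt (𝓡 n) p).left_inv hx⟩
  rw [(extChartAt (𝓡 n) p).right_inv hz, chartMetric_apply, chartSymmDeriv_chartDeriv hz,
    chartSymmDeriv_chartDeriv hz]

theorem inner_self_eq_chartMetric (p : M) (v w : TangentSpace (𝓡 n) p) :
    g.inner p v w = chartMetric g p (extChartAt (𝓡 n) p p) v w := by
  rw [inner_eq_chartMetric g (mem_extChartAt_source (I := 𝓡 n) p), chartDeriv_self, chartDeriv_self]

theorem chartMetric_symm (p : M) (z a b : EuclideanSpace ℝ (Fin n)) :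
    chartMetric g p z a b = chartMetric g p z b a := g.symm _ _ _

theorem chartMetric_pos {p : M} {z : EuclideanSpace ℝ (Fin n)}
    (hz : z ∈ (extChartAt (𝓡 n) p).target) {a : EuclideanSpace ℝ (Fin n)} (ha : a ≠ 0) :
    0 < chartMetric g p z a a := by
  refine g.pos _ _ fun h => ha ?_
  rw [← chartDeriv_chartSymmDeriv hz a, h, map_zero]

/-- The field is the image of the constant section `y ↦ (y, a)` under the tangent map of the inverse
chart. -/
theorem contMDiffAt_chartSymmDeriv {p : M} {z : EuclideanSpace ℝ (Fin n)}
    (hz : z ∈ (extChartAt (𝓡 n) p).target) (a : EuclideanSpace ℝ (Fin n)) :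
    ContMDiffAt 𝓘(ℝ, EuclideanSpace ℝ (Fin n)) (𝓡 n).tangent ∞
      (fun y => (⟨(extChartAt (𝓡 n) p).symm y, chartSymmDeriv p y a⟩ : TangentBundle (𝓡 n) M))
      z := by
  have ht : IsOpen (extChartAt (𝓡 n) p).target := isOpen_extChartAt_target p
  have h := (contMDiffOn_extChartAt_symm (I := 𝓡 n) (n := ∞) p).contMDiffOn_tangentMapWithin
    (m := ∞) (by simp) ht.uniqueMDiffOn
  have hc : ContMDiff 𝓘(ℝ, EuclideanSpace ℝ (Fin n))
      𝓘(ℝ, EuclideanSpace ℝ (Fin n)).tangent ∞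
      (fun y => (⟨y, a⟩ : TangentBundle 𝓘(ℝ, EuclideanSpace ℝ (Fin n))
        (EuclideanSpace ℝ (Fin n)))) := by
    intro y
    rw [Bundle.contMDiffAt_totalSpace]
    refine ⟨contMDiffAt_id, ?_⟩
    simpa using! contMDiffAt_const
  have h2 := (h.comp (s := (extChartAt (𝓡 n) p).target) hc.contMDiffOn
    (fun y hy => hy)).contMDiffAt (ht.mem_nhds hz)
  refine h2.congr_of_eventuallyEq ?_
  filter_upwards [ht.mem_nhds hz] with y hy
  simp only [Function.comp, tangentMapWithin, chartSymmDeriv, mfderivWithin_of_isOpen ht hy]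
  rfl

/-- In finite dimension, smoothness of a bilinear form may be tested on fixed vectors, where it
becomes smooth evaluation in the bundle. -/
theorem contDiffOn_chartMetric {K : Set ℝ} {g : ℝ → SmoothMetric n M}
    (hg : ContMDiffOn ((𝓡 n).prod 𝓘(ℝ, ℝ))
      ((𝓡 n).prod 𝓘(ℝ, EuclideanSpace ℝ (Fin n) →L[ℝ] EuclideanSpace ℝ (Fin n) →L[ℝ] ℝ)) ∞
      (fun p : M × ℝ => Bundle.TotalSpace.mk'
        (EuclideanSpace ℝ (Fin n) →L[ℝ] EuclideanSpace ℝ (Fin n) →L[ℝ] ℝ)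
        (E := fun x : M => TangentSpace (𝓡 n) x →L[ℝ] TangentSpace (𝓡 n) x →L[ℝ] ℝ)
        p.1 ((g p.2).inner p.1))
      (univ ×ˢ K)) (p : M) :
    ContDiffOn ℝ ∞ (fun q : EuclideanSpace ℝ (Fin n) × ℝ => chartMetric (g q.2) p q.1)
      ((extChartAt (𝓡 n) p).target ×ˢ K) := by
  rw [contDiffOn_clm_apply]
  intro a
  rw [contDiffOn_clm_apply]
  intro b q hq
  rw [← contMDiffWithinAt_iff_contDiffWithinAt, modelWithCornersSelf_prod, ← chartedSpaceSelf_prod]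
  have hfst : ContMDiffWithinAt (𝓘(ℝ, EuclideanSpace ℝ (Fin n)).prod 𝓘(ℝ, ℝ))
      𝓘(ℝ, EuclideanSpace ℝ (Fin n)) ∞ (Prod.fst : EuclideanSpace ℝ (Fin n) × ℝ → _)
      ((extChartAt (𝓡 n) p).target ×ˢ K) q := contMDiffWithinAt_fst
  have hsymm : ContMDiffWithinAt (𝓘(ℝ, EuclideanSpace ℝ (Fin n)).prod 𝓘(ℝ, ℝ))
      (𝓡 n) ∞ (fun q : EuclideanSpace ℝ (Fin n) × ℝ => (extChartAt (𝓡 n) p).symm q.1)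
      ((extChartAt (𝓡 n) p).target ×ˢ K) q :=
    ((contMDiffOn_extChartAt_symm (I := 𝓡 n) (n := ∞) p q.1 hq.1).contMDiffAt
      ((isOpen_extChartAt_target p).mem_nhds hq.1)).comp_contMDiffWithinAt q hfst
  have hvec : ∀ c : EuclideanSpace ℝ (Fin n),
      ContMDiffWithinAt (𝓘(ℝ, EuclideanSpace ℝ (Fin n)).prod 𝓘(ℝ, ℝ)) (𝓡 n).tangent ∞
      (fun y : EuclideanSpace ℝ (Fin n) × ℝ => (⟨(extChartAt (𝓡 n) p).symm y.1,
        chartSymmDeriv p y.1 c⟩ : TangentBundle (𝓡 n) M))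
      ((extChartAt (𝓡 n) p).target ×ˢ K) q := fun c =>
    (contMDiffAt_chartSymmDeriv hq.1 c).comp_contMDiffWithinAt q hfst
  have hin := (hg ((extChartAt (𝓡 n) p).symm q.1, q.2) ⟨mem_univ _, hq.2⟩).comp q
    (t := univ ×ˢ K) (s := (extChartAt (𝓡 n) p).target ×ˢ K)
    (f := fun y : EuclideanSpace ℝ (Fin n) × ℝ => ((extChartAt (𝓡 n) p).symm y.1, y.2))
    (hsymm.prodMk contMDiffWithinAt_snd) (fun y hy => ⟨mem_univ _, hy.2⟩)
  have h := ContMDiffWithinAt.clm_bundle_apply₂ (F₁ := EuclideanSpace ℝ (Fin n))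
    (F₂ := EuclideanSpace ℝ (Fin n)) (F₃ := ℝ) (E₁ := (TangentSpace (𝓡 n) : M → Type _))
    (E₂ := (TangentSpace (𝓡 n) : M → Type _)) (E₃ := Bundle.Trivial M ℝ)
    (b := fun q : EuclideanSpace ℝ (Fin n) × ℝ => (extChartAt (𝓡 n) p).symm q.1)
    hin (hvec a) (hvec b)
  rw [Bundle.contMDiffWithinAt_totalSpace] at h
  exact h.2

end SmoothMetric

/-! Gram matrices and metric traces -/

namespace SmoothMetric

variable {n : ℕ}

/-- The Gram matrix of a bilinear form on `ℝⁿ`. -/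
def gram (b : EuclideanSpace ℝ (Fin n) →L[ℝ] EuclideanSpace ℝ (Fin n) →L[ℝ] ℝ) :
    Matrix (Fin n) (Fin n) ℝ :=
  Matrix.of fun i j => b (stdVec i) (stdVec j)

theorem eq_sum_smul_stdVec (v : EuclideanSpace ℝ (Fin n)) : v = ∑ i, v i • stdVec i := by
  ext j
  simp [stdVec, Pi.single_apply]

theorem bilin_eq_dotProduct
    (b : EuclideanSpace ℝ (Fin n) →L[ℝ] EuclideanSpace ℝ (Fin n) →L[ℝ] ℝ)
    (v w : EuclideanSpace ℝ (Fin n)) : b v w = v.ofLp ⬝ᵥ (gram b).mulVec w.ofLp := by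
  conv_lhs => rw [eq_sum_smul_stdVec v, eq_sum_smul_stdVec w]
  simp [dotProduct, Matrix.mulVec, gram, Finset.mul_sum]
  rw [Finset.sum_comm]
  exact Finset.sum_congr rfl fun i _ => Finset.sum_congr rfl fun j _ => by ring

theorem isUnit_det_gram {b : EuclideanSpace ℝ (Fin n) →L[ℝ] EuclideanSpace ℝ (Fin n) →L[ℝ] ℝ}
    (hb : ∀ a, a ≠ 0 → 0 < b a a) : IsUnit (gram b).det := by
  rw [isUnit_iff_ne_zero]
  intro h
  obtain ⟨v, hv, hv0⟩ := Matrix.exists_mulVec_eq_zero_iff.2 h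
  have := hb (WithLp.toLp 2 v) (by simpa using hv)
  rw [bilin_eq_dotProduct] at this
  simp [hv0] at this

/-- The trace of the bilinear form `r` with respect to the metric `b`. -/
def metricTrace (b r : EuclideanSpace ℝ (Fin n) →L[ℝ] EuclideanSpace ℝ (Fin n) →L[ℝ] ℝ) : ℝ :=
  ∑ j, ∑ k, (gram b)⁻¹ j k * r (stdVec j) (stdVec k)

theorem metricTrace_eq (b r : EuclideanSpace ℝ (Fin n) →L[ℝ] EuclideanSpace ℝ (Fin n) →L[ℝ] ℝ) :
    metricTrace b r = ((gram b)⁻¹ * (gram r).transpose).trace := by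
  simp [metricTrace, Matrix.trace, Matrix.mul_apply, gram]

/-- With `P` the matrix of `A`, Gram matrices become `Pᵀ G P`, and `P` cancels by cyclicity of the
trace. A left inverse suffices, the matrices being square. -/
theorem metricTrace_comp
    {b r b' r' : EuclideanSpace ℝ (Fin n) →L[ℝ] EuclideanSpace ℝ (Fin n) →L[ℝ] ℝ}
    {A A' : EuclideanSpace ℝ (Fin n) →ₗ[ℝ] EuclideanSpace ℝ (Fin n)}
    (hA : ∀ v, A' (A v) = v)
    (hb : ∀ v w, b' v w = b (A v) (A w)) (hr : ∀ v w, r' v w = r (A v) (A w)) :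
    metricTrace b' r' = metricTrace b r := by
  set P : Matrix (Fin n) (Fin n) ℝ := Matrix.of fun i j => A (stdVec j) i with hP
  set P' : Matrix (Fin n) (Fin n) ℝ := Matrix.of fun i j => A' (stdVec j) i with hP'
  have hmul : P' * P = 1 := by
    ext i j
    have h := congrArg (fun v : EuclideanSpace ℝ (Fin n) => v i) (hA (stdVec j))
    simp only at h
    rw [eq_sum_smul_stdVec (A (stdVec j))] at h
    simp only [map_sum, map_smul] at h
    simp only [Matrix.mul_apply, hP, hP', Matrix.of_apply, Matrix.one_apply]
    simp only [stdVec, WithLp.ofLp_sum, WithLp.ofLp_smul, Finset.sum_apply, Pi.smul_apply,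
      smul_eq_mul, PiLp.single_apply] at h ⊢
    rw [← h]
    exact Finset.sum_congr rfl fun _ _ => mul_comm _ _
  have hmul' : P * P' = 1 := mul_eq_one_comm.1 hmul
  have hgram : ∀ {c c' : EuclideanSpace ℝ (Fin n) →L[ℝ] EuclideanSpace ℝ (Fin n) →L[ℝ] ℝ},
      (∀ v w, c' v w = c (A v) (A w)) → gram c' = P.transpose * gram c * P := by
    intro c c' hc
    ext i j
    rw [gram, Matrix.of_apply, hc, bilin_eq_dotProduct, Matrix.mul_assoc]
    simp [Matrix.mul_apply, dotProduct, Matrix.mulVec, hP]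
  have hT : P'.transpose * P.transpose = 1 := by
    rw [← Matrix.transpose_mul, hmul', Matrix.transpose_one]
  have hT' : P.transpose * P'.transpose = 1 := by
    rw [← Matrix.transpose_mul, hmul, Matrix.transpose_one]
  have hinv : P⁻¹ = P' := Matrix.inv_eq_left_inv hmul
  have hinvT : (P.transpose)⁻¹ = P'.transpose := Matrix.inv_eq_left_inv hT
  rw [metricTrace_eq, metricTrace_eq, hgram hb, hgram hr]
  rw [Matrix.mul_inv_rev, Matrix.mul_inv_rev, hinv, hinvT, Matrix.transpose_mul,
    Matrix.transpose_mul, Matrix.transpose_transpose]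
  calc (P' * ((gram b)⁻¹ * P'.transpose) * (P.transpose * ((gram r).transpose * P))).trace
      = (P' * (gram b)⁻¹ * (P'.transpose * P.transpose) * (gram r).transpose * P).trace := by
        simp only [Matrix.mul_assoc]
    _ = (P * (P' * (gram b)⁻¹ * (gram r).transpose)).trace := by
        rw [hT, Matrix.mul_one, Matrix.trace_mul_comm]
    _ = _ := by rw [Matrix.mul_assoc P', ← Matrix.mul_assoc, hmul', Matrix.one_mul]

theorem contDiffWithinAt_det {V : Type*} [NormedAddCommGroup V] [NormedSpace ℝ V]
    {k : WithTop ℕ∞} {f : V → Matrix (Fin n) (Fin n) ℝ} {s : Set V} {x : V}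
    (hf : ∀ i j, ContDiffWithinAt ℝ k (fun y => f y i j) s x) :
    ContDiffWithinAt ℝ k (fun y => (f y).det) s x := by
  simp only [Matrix.det_apply']
  exact ContDiffWithinAt.sum fun σ _ => contDiffWithinAt_const.mul
    (contDiffWithinAt_prod fun i _ => hf _ _)

theorem contDiffWithinAt_inv {V : Type*} [NormedAddCommGroup V] [NormedSpace ℝ V]
    {k : WithTop ℕ∞} {f : V → Matrix (Fin n) (Fin n) ℝ} {s : Set V} {x : V}
    (hf : ∀ i j, ContDiffWithinAt ℝ k (fun y => f y i j) s x) (hx : (f x).det ≠ 0) (i j : Fin n) :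
    ContDiffWithinAt ℝ k (fun y => (f y)⁻¹ i j) s x := by
  simp only [Matrix.inv_def, Ring.inverse_eq_inv', Matrix.smul_apply, smul_eq_mul,
    Matrix.adjugate_apply]
  refine ((contDiffWithinAt_det hf).inv hx).mul (contDiffWithinAt_det fun a b => ?_)
  simp only [Matrix.updateRow_apply]
  split_ifs
  · exact contDiffWithinAt_const
  · exact hf _ _

theorem contDiffWithinAt_metricTrace {V : Type*} [NormedAddCommGroup V] [NormedSpace ℝ V]
    {k : WithTop ℕ∞}
    {b r : V → EuclideanSpace ℝ (Fin n) →L[ℝ] EuclideanSpace ℝ (Fin n) →L[ℝ] ℝ} {s : Set V} {x : V}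
    (hb : ContDiffWithinAt ℝ k b s x) (hr : ContDiffWithinAt ℝ k r s x)
    (hx : ∀ a, a ≠ 0 → 0 < b x a a) :
    ContDiffWithinAt ℝ k (fun y => metricTrace (b y) (r y)) s x :=
  ContDiffWithinAt.sum fun i _ => ContDiffWithinAt.sum fun j _ =>
    (contDiffWithinAt_inv (fun _ _ => (hb.clm_apply contDiffWithinAt_const).clm_apply
      contDiffWithinAt_const) (isUnit_det_gram hx).ne_zero i j).mul
      ((hr.clm_apply contDiffWithinAt_const).clm_apply contDiffWithinAt_const)

/-- Raising the index of `L` and pairing with the metric recovers `L`. Both `sharp` and the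
Christoffel symbols have this form. -/
theorem bilin_inv_mulVec
    {b : EuclideanSpace ℝ (Fin n) →L[ℝ] EuclideanSpace ℝ (Fin n) →L[ℝ] ℝ}
    (hb : ∀ a, a ≠ 0 → 0 < b a a) (L : EuclideanSpace ℝ (Fin n) →ₗ[ℝ] ℝ)
    (w : EuclideanSpace ℝ (Fin n)) :
    b w (WithLp.toLp 2 ((gram b)⁻¹.mulVec fun j => L (stdVec j))) = L w := by
  rw [bilin_eq_dotProduct, Matrix.mulVec_mulVec, Matrix.mul_nonsing_inv _ (isUnit_det_gram hb),
    Matrix.one_mulVec]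
  conv_rhs => rw [eq_sum_smul_stdVec w, map_sum]
  simp [dotProduct]

variable {M : Type*} [TopologicalSpace M] [ChartedSpace (EuclideanSpace ℝ (Fin n)) M]
  [IsManifold (𝓡 n) ∞ M]

theorem inner_sharp (g : SmoothMetric n M) (x : M) (ℓ : TangentSpace (𝓡 n) x →ₗ[ℝ] ℝ)
    (v : TangentSpace (𝓡 n) x) : g.inner x v (sharp g x ℓ) = ℓ v :=
  bilin_inv_mulVec (b := g.inner x) (fun a ha => g.pos x a ha) ℓ v

theorem ricci_stdVec (g : SmoothMetric n M) (x : M) (j k : Fin n) :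
    ricci g x (stdVec j : EuclideanSpace ℝ (Fin n)) (stdVec k : EuclideanSpace ℝ (Fin n)) =
      ricciCoeff g x (extChartAt (𝓡 n) x x) j k := by
  have h := LinearMap.BilinForm.toMatrix_apply (EuclideanSpace.basisFun (Fin n) ℝ).toBasis
    (Matrix.toBilin (EuclideanSpace.basisFun (Fin n) ℝ).toBasis
      (ricciCoeff g x (extChartAt (𝓡 n) x x))) j k
  rw [LinearMap.BilinForm.toMatrix_toBilin, OrthonormalBasis.coe_toBasis,
    EuclideanSpace.basisFun_apply, EuclideanSpace.basisFun_apply] at h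
  exact h.symm

end SmoothMetric

/-! Christoffel symbols, and the flow in a chart -/

namespace SmoothMetric

variable {n : ℕ} {M : Type*} [TopologicalSpace M] [ChartedSpace (EuclideanSpace ℝ (Fin n)) M]
  [IsManifold (𝓡 n) ∞ M]

theorem bilin_eq_sum {n : ℕ}
    (b : EuclideanSpace ℝ (Fin n) →L[ℝ] EuclideanSpace ℝ (Fin n) →L[ℝ] ℝ)
    (v w : EuclideanSpace ℝ (Fin n)) :
    b v w = ∑ i, ∑ j, b (stdVec i) (stdVec j) * v i * w j := by
  rw [bilin_eq_dotProduct]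
  simp only [dotProduct, Matrix.mulVec, gram, Finset.mul_sum, Matrix.of_apply]
  exact Finset.sum_congr rfl fun i _ => Finset.sum_congr rfl fun j _ => by ring

theorem partialDeriv_metricCoeff {g : SmoothMetric n M} {p : M} {z : EuclideanSpace ℝ (Fin n)}
    {D : EuclideanSpace ℝ (Fin n) →L[ℝ]
      EuclideanSpace ℝ (Fin n) →L[ℝ] EuclideanSpace ℝ (Fin n) →L[ℝ] ℝ}
    (hD : HasFDerivAt (chartMetric g p) D z) (i j l : Fin n) :
    partialDeriv i (fun y => metricCoeff g p y j l) z = D (stdVec i) (stdVec j) (stdVec l) := by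
  have h := (hD.clm_apply (hasFDerivAt_const (stdVec j) z)).clm_apply
    (hasFDerivAt_const (stdVec l) z)
  rw [partialDeriv, show (fun y => metricCoeff g p y j l) =
    fun y => chartMetric g p y (stdVec j) (stdVec l) from rfl, h.fderiv]
  simp

/-- Koszul's formula for the Christoffel symbols. -/
theorem chartMetric_christoffel {g : SmoothMetric n M} {p : M} {z : EuclideanSpace ℝ (Fin n)}
    (hz : z ∈ (extChartAt (𝓡 n) p).target)
    {D : EuclideanSpace ℝ (Fin n) →L[ℝ]
      EuclideanSpace ℝ (Fin n) →L[ℝ] EuclideanSpace ℝ (Fin n) →L[ℝ] ℝ}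
    (hD : HasFDerivAt (chartMetric g p) D z) (a v w : EuclideanSpace ℝ (Fin n)) :
    chartMetric g p z a (WithLp.toLp 2 fun k => ∑ i, ∑ j, christoffel g p k i j z * v i * w j) =
      (1 / 2) * (D v w a + D w v a - D a v w) := by
  let L : EuclideanSpace ℝ (Fin n) →ₗ[ℝ] ℝ :=
    ((1 / 2 : ℝ) • (D v w + D w v - (D.flip v).flip w)).toLinearMap
  have hL : ∀ c, L c = (1 / 2) * (D v w c + D w v c - D c v w) := fun c => rfl
  -- The right side becomes the pairing of `a` with the raised covector `L`, so it suffices to match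
  -- the vectors componentwise.
  rw [← hL, ← bilin_inv_mulVec (b := chartMetric g p z) (fun _ => chartMetric_pos g hz) L a]
  congr 2
  ext k
  simp only [Matrix.mulVec, dotProduct, christoffel, partialDeriv_metricCoeff hD, hL]
  let B := (ContinuousLinearMap.compL ℝ (EuclideanSpace ℝ (Fin n))
    (EuclideanSpace ℝ (Fin n) →L[ℝ] ℝ) ℝ)
  have h : ∀ c, D v w c + D w v c - D c v w = ∑ i, ∑ j, (D (stdVec i) (stdVec j) c
      + D (stdVec j) (stdVec i) c - D c (stdVec i) (stdVec j)) * v i * w j := by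
    intro c
    have h1 := bilin_eq_sum ((B (ContinuousLinearMap.apply ℝ ℝ c)).comp D) v w
    have h2 := bilin_eq_sum ((B (ContinuousLinearMap.apply ℝ ℝ c)).comp D).flip v w
    have h3 := bilin_eq_sum (D c) v w
    simp only [B, ContinuousLinearMap.flip_apply, ContinuousLinearMap.comp_apply,
      ContinuousLinearMap.compL_apply, ContinuousLinearMap.apply_apply] at h1 h2 h3
    rw [h1, h2, h3]
    simp only [← Finset.sum_add_distrib, ← Finset.sum_sub_distrib]
    exact Finset.sum_congr rfl fun i _ => Finset.sum_congr rfl fun j _ => by ring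
  simp only [h, Finset.mul_sum, Finset.sum_mul]
  rw [Finset.sum_comm_cycle, show metricCoeff g p z = gram (chartMetric g p z) from rfl]
  refine Finset.sum_congr rfl fun l _ => Finset.sum_congr rfl fun i _ =>
    Finset.sum_congr rfl fun j _ => by ring

/-- A family of metrics in the preferred chart at `p`, as a function of space and time. -/
def flowMetric (g : ℝ → SmoothMetric n M) (p : M) (q : EuclideanSpace ℝ (Fin n) × ℝ) :
    EuclideanSpace ℝ (Fin n) →L[ℝ] EuclideanSpace ℝ (Fin n) →L[ℝ] ℝ :=
  chartMetric (g q.2) p q.1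

/-- The time derivative of a family of metrics in the preferred chart at `p`. -/
def flowMetricDt (g : ℝ → SmoothMetric n M) (K : Set ℝ) (p : M)
    (q : EuclideanSpace ℝ (Fin n) × ℝ) :
    EuclideanSpace ℝ (Fin n) →L[ℝ] EuclideanSpace ℝ (Fin n) →L[ℝ] ℝ :=
  fderivWithin ℝ (flowMetric g p) ((extChartAt (𝓡 n) p).target ×ˢ K) q (0, 1)

variable {g : ℝ → SmoothMetric n M} {K : Set ℝ}

omit [IsManifold (𝓡 n) ∞ M] in
theorem uniqueDiffOn_target_prod (hK : UniqueDiffOn ℝ K) (p : M) :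
    UniqueDiffOn ℝ ((extChartAt (𝓡 n) p).target ×ˢ K) :=
  (isOpen_extChartAt_target p).uniqueDiffOn.prod hK

theorem contDiffOn_flowMetric (hg : IsBackwardRicciFlow g K) (p : M) :
    ContDiffOn ℝ ∞ (flowMetric g p) ((extChartAt (𝓡 n) p).target ×ˢ K) :=
  contDiffOn_chartMetric hg.smooth p

theorem contDiffOn_flowMetricDt (hg : IsBackwardRicciFlow g K) (hK : UniqueDiffOn ℝ K) (p : M) :
    ContDiffOn ℝ ∞ (flowMetricDt g K p) ((extChartAt (𝓡 n) p).target ×ˢ K) :=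
  ((contDiffOn_flowMetric hg p).fderivWithin (uniqueDiffOn_target_prod hK p) (m := ∞)
    (by simp)).clm_apply contDiffOn_const

theorem flowMetricDt_apply (hg : IsBackwardRicciFlow g K) (hK : UniqueDiffOn ℝ K) {p : M}
    {z : EuclideanSpace ℝ (Fin n)} (hz : z ∈ (extChartAt (𝓡 n) p).target) {τ : ℝ} (hτ : τ ∈ K)
    (a b : EuclideanSpace ℝ (Fin n)) :
    flowMetricDt g K p (z, τ) a b = 2 * ricci (g τ) ((extChartAt (𝓡 n) p).symm z)
      (chartSymmDeriv p z a) (chartSymmDeriv p z b) := by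
  have h1 := hg.flow τ hτ ((extChartAt (𝓡 n) p).symm z) (chartSymmDeriv p z a)
    (chartSymmDeriv p z b)
  have h2 : HasDerivWithinAt (fun σ => flowMetric g p (z, σ)) (flowMetricDt g K p (z, τ)) K τ :=
    (((contDiffOn_flowMetric hg p).differentiableOn (by simp) (z, τ)
      ⟨hz, hτ⟩).hasFDerivWithinAt).comp_hasDerivWithinAt τ
      ((hasDerivWithinAt_const τ K z).prodMk (hasDerivWithinAt_id τ K)) (fun σ hσ => ⟨hz, hσ⟩)
  have h3 := (h2.clm_apply (hasDerivWithinAt_const τ K a)).clm_apply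
    (hasDerivWithinAt_const τ K b)
  have h4 := (hK τ hτ).eq_deriv _ h3 h1
  simpa using h4

/-- Along the flow, the scalar curvature is the trace of half the time derivative of the metric,
in any chart. -/
theorem scalarCurvature_eq_metricTrace (hg : IsBackwardRicciFlow g K) (hK : UniqueDiffOn ℝ K)
    {p x : M} (hx : x ∈ (extChartAt (𝓡 n) p).source) {τ : ℝ} (hτ : τ ∈ K) :
    scalarCurvature (g τ) x = metricTrace (flowMetric g p (extChartAt (𝓡 n) p x, τ))
      ((1 / 2 : ℝ) • flowMetricDt g K p (extChartAt (𝓡 n) p x, τ)) := by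
  obtain ⟨z, hz, rfl⟩ : ∃ z ∈ (extChartAt (𝓡 n) p).target, (extChartAt (𝓡 n) p).symm z = x :=
    ⟨_, (extChartAt (𝓡 n) p).map_source hx, (extChartAt (𝓡 n) p).left_inv hx⟩
  rw [(extChartAt (𝓡 n) p).right_inv hz]
  set x := (extChartAt (𝓡 n) p).symm z with hxz
  let r : EuclideanSpace ℝ (Fin n) →L[ℝ] EuclideanSpace ℝ (Fin n) →L[ℝ] ℝ :=
    LinearMap.toContinuousLinearMap (LinearMap.toContinuousLinearMap.toLinearMap ∘ₗ
      (ricci (g τ) x : EuclideanSpace ℝ (Fin n) →ₗ[ℝ] EuclideanSpace ℝ (Fin n) →ₗ[ℝ] ℝ))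
  have hr : ∀ v w, r v w = ricci (g τ) x v w := fun _ _ => rfl
  have hgram : metricCoeff (g τ) x (extChartAt (𝓡 n) x x) =
      gram (chartMetric (g τ) x (extChartAt (𝓡 n) x x)) := rfl
  have h1 : scalarCurvature (g τ) x =
      metricTrace (chartMetric (g τ) x (extChartAt (𝓡 n) x x)) r := by
    rw [scalarCurvature, metricTrace]
    refine Finset.sum_congr rfl fun j _ => Finset.sum_congr rfl fun k _ => ?_
    rw [hr, ricci_stdVec, hgram]
  rw [h1]
  symm
  -- The change of basis is the differential of the inverse chart at `p`, read in the chart at `x`,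
  -- where curvature is defined.
  refine metricTrace_comp (A := (chartSymmDeriv p z).toLinearMap)
    (A' := (chartDeriv p x).toLinearMap) (fun v => chartDeriv_chartSymmDeriv hz v) ?_ ?_
  · intro v w
    exact inner_self_eq_chartMetric (g τ) x (chartSymmDeriv p z v) (chartSymmDeriv p z w)
  · intro v w
    rw [hr, smul_apply, smul_apply, flowMetricDt_apply hg hK hz hτ, smul_eq_mul]
    rw [← mul_assoc]; norm_num
    rfl

set_option synthInstance.maxHeartbeats 200000 in
theorem contDiffOn_chartScalarCurvature (hg : IsBackwardRicciFlow g K) (hK : UniqueDiffOn ℝ K)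
    (p : M) :
    ContDiffOn ℝ ∞ (fun q => metricTrace (flowMetric g p q) ((1 / 2 : ℝ) • flowMetricDt g K p q))
      ((extChartAt (𝓡 n) p).target ×ˢ K) := fun q hq =>
  contDiffWithinAt_metricTrace (contDiffOn_flowMetric hg p q hq)
    ((contDiffOn_flowMetricDt hg hK p q hq).const_smul _)
    fun _ => chartMetric_pos (g q.2) hq.1

theorem mdifferentiableAt_scalarCurvature (hg : IsBackwardRicciFlow g K) (hK : UniqueDiffOn ℝ K)
    (x : M) {τ : ℝ} (hτ : τ ∈ K) :
    MDifferentiableAt (𝓡 n) 𝓘(ℝ, ℝ) (scalarCurvature (g τ)) x := by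
  have hS : DifferentiableAt ℝ (fun z => metricTrace (flowMetric g x (z, τ))
      ((1 / 2 : ℝ) • flowMetricDt g K x (z, τ))) (extChartAt (𝓡 n) x x) := by
    have h : ContDiffOn ℝ ∞ (fun z => metricTrace (flowMetric g x (z, τ))
      ((1 / 2 : ℝ) • flowMetricDt g K x (z, τ))) (extChartAt (𝓡 n) x).target :=
      (contDiffOn_chartScalarCurvature hg hK x).comp (contDiffOn_id.prodMk contDiffOn_const)
        (fun z hz => ⟨hz, hτ⟩)
    exact (h.contDiffAt (extChartAt_target_mem_nhds x)).differentiableAt (by simp)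
  have hc := hS.mdifferentiableAt.comp x
    (mdifferentiableAt_extChartAt (I := 𝓡 n) (mem_chart_source _ x))
  refine hc.congr_of_eventuallyEq ?_
  filter_upwards [extChartAt_source_mem_nhds (I := 𝓡 n) x] with y hy
  exact scalarCurvature_eq_metricTrace hg hK hy hτ

end SmoothMetric

/-! Families of curves in a chart -/

namespace SmoothMetric

variable {n : ℕ} {M : Type*} [TopologicalSpace M] [ChartedSpace (EuclideanSpace ℝ (Fin n)) M]
  [IsManifold (𝓡 n) ∞ M]

/-- A family of curves in the preferred chart at `p`. -/
def chartFamily (γ : ℝ → ℝ → M) (p : M) (q : ℝ × ℝ) : EuclideanSpace ℝ (Fin n) :=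
  extChartAt (𝓡 n) p (γ q.1 q.2)

variable {γ : ℝ → ℝ → M} {S K : Set ℝ}

omit [IsManifold (𝓡 n) ∞ M] in
theorem eventually_mem_source
    (hγ : ContMDiffOn 𝓘(ℝ, ℝ × ℝ) (𝓡 n) ∞ (fun p : ℝ × ℝ => γ p.1 p.2) (S ×ˢ K))
    {q : ℝ × ℝ} (hq : q ∈ S ×ˢ K) :
    ∀ᶠ r in 𝓝[S ×ˢ K] q, γ r.1 r.2 ∈ (extChartAt (𝓡 n) (γ q.1 q.2)).source :=
  (hγ q hq).continuousWithinAt (extChartAt_source_mem_nhds (I := 𝓡 n) (γ q.1 q.2))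

theorem contDiffWithinAt_chartFamily
    (hγ : ContMDiffOn 𝓘(ℝ, ℝ × ℝ) (𝓡 n) ∞ (fun p : ℝ × ℝ => γ p.1 p.2) (S ×ˢ K))
    {p : M} {q : ℝ × ℝ} (hq : q ∈ S ×ˢ K) (hp : γ q.1 q.2 ∈ (extChartAt (𝓡 n) p).source) :
    ContDiffWithinAt ℝ ∞ (chartFamily (n := n) γ p) (S ×ˢ K) q := by
  rw [← contMDiffWithinAt_iff_contDiffWithinAt]
  exact (contMDiffAt_extChartAt' (by simpa using hp)).comp_contMDiffWithinAt q (hγ q hq)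

/-- Both sides are the derivative within `K` of the same coordinate curve, which is unique. -/
theorem chartDeriv_velocity
    (hγ : ContMDiffOn 𝓘(ℝ, ℝ × ℝ) (𝓡 n) ∞ (fun p : ℝ × ℝ => γ p.1 p.2) (S ×ˢ K))
    (hK : UniqueDiffOn ℝ K)
    {p : M} {s τ : ℝ} (hs : s ∈ S) (hτ : τ ∈ K) (hp : γ s τ ∈ (extChartAt (𝓡 n) p).source) :
    chartDeriv p (γ s τ) (velocity K (γ s) τ) =
      fderivWithin ℝ (chartFamily (n := n) γ p) (S ×ˢ K) (s, τ) (0, 1) := by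
  have hu := ((contDiffWithinAt_chartFamily hγ ⟨hs, hτ⟩ hp).differentiableWithinAt
    (by simp)).hasFDerivWithinAt.comp_hasDerivWithinAt τ
    ((hasDerivWithinAt_const τ K s).prodMk (hasDerivWithinAt_id τ K)) (fun σ hσ => ⟨hs, hσ⟩)
  have hc : MDifferentiableWithinAt 𝓘(ℝ, ℝ) (𝓡 n) (γ s) K τ :=
    ((hγ (s, τ) ⟨hs, hτ⟩).mdifferentiableWithinAt (by simp)).comp τ
      (f := fun σ => (s, σ)) (u := S ×ˢ K)
      ((differentiableWithinAt_const s).prodMk differentiableWithinAt_id).mdifferentiableWithinAt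
      (fun σ hσ => ⟨hs, hσ⟩)
  have hcomp := (mdifferentiableAt_extChartAt (I := 𝓡 n) (x := p)
    (by simpa using hp)).hasMFDerivAt.comp_hasMFDerivWithinAt τ hc.hasMFDerivWithinAt
  let L : ℝ →L[ℝ] EuclideanSpace ℝ (Fin n) :=
    (chartDeriv p (γ s τ)).comp (mfderivWithin 𝓘(ℝ, ℝ) (𝓡 n) (γ s) K τ)
  have hL : HasFDerivWithinAt (fun σ => chartFamily (n := n) γ p (s, σ)) L K τ :=
    hasMFDerivWithinAt_iff_hasFDerivWithinAt.1 hcomp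
  have hd : HasDerivWithinAt (fun σ => chartFamily (n := n) γ p (s, σ)) (L 1) K τ :=
    hL.hasDerivWithinAt
  exact (hK τ hτ).eq_deriv _ hd hu

omit [IsManifold (𝓡 n) ∞ M] in
theorem mdifferentiableAt_family
    (hγ : ContMDiffOn 𝓘(ℝ, ℝ × ℝ) (𝓡 n) ∞ (fun p : ℝ × ℝ => γ p.1 p.2) (S ×ˢ K))
    (hS : S ∈ 𝓝 0) {τ : ℝ} (hτ : τ ∈ K) :
    MDifferentiableAt 𝓘(ℝ, ℝ) (𝓡 n) (fun s => γ s τ) 0 := by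
  have hc : MDifferentiableWithinAt 𝓘(ℝ, ℝ) (𝓡 n) (fun s => γ s τ) S 0 :=
    ((hγ (0, τ) ⟨mem_of_mem_nhds hS, hτ⟩).mdifferentiableWithinAt (by simp)).comp 0
      (f := fun s => (s, τ)) (u := S ×ˢ K)
      (differentiableWithinAt_id.prodMk (differentiableWithinAt_const τ)).mdifferentiableWithinAt
      (fun σ hσ => ⟨hσ, hτ⟩)
  exact hc.mdifferentiableAt hS

theorem chartDeriv_variationField
    (hγ : ContMDiffOn 𝓘(ℝ, ℝ × ℝ) (𝓡 n) ∞ (fun p : ℝ × ℝ => γ p.1 p.2) (S ×ˢ K))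
    (hS : S ∈ 𝓝 0) {p : M} {τ : ℝ} (hτ : τ ∈ K)
    (hp : γ 0 τ ∈ (extChartAt (𝓡 n) p).source) :
    chartDeriv p (γ 0 τ) (variationField γ τ) =
      fderivWithin ℝ (chartFamily (n := n) γ p) (S ×ˢ K) (0, τ) (1, 0) := by
  have hu := (((contDiffWithinAt_chartFamily hγ ⟨mem_of_mem_nhds hS, hτ⟩ hp).differentiableWithinAt
    (by simp)).hasFDerivWithinAt.comp_hasDerivWithinAt 0
    ((hasDerivWithinAt_id 0 S).prodMk (hasDerivWithinAt_const 0 S τ))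
    (fun σ hσ => ⟨hσ, hτ⟩)).hasDerivAt hS
  have hcomp := (mdifferentiableAt_extChartAt (I := 𝓡 n) (x := p)
    (by simpa using hp)).hasMFDerivAt.comp 0 (mdifferentiableAt_family hγ hS hτ).hasMFDerivAt
  let L : ℝ →L[ℝ] EuclideanSpace ℝ (Fin n) :=
    (chartDeriv p (γ 0 τ)).comp (mfderiv 𝓘(ℝ, ℝ) (𝓡 n) (fun s => γ s τ) 0)
  have hL : HasFDerivAt (fun s => chartFamily (n := n) γ p (s, τ)) L 0 :=
    hasMFDerivAt_iff_hasFDerivAt.1 hcomp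
  have hd : HasDerivAt (fun s => chartFamily (n := n) γ p (s, τ)) (L 1) 0 := hL.hasDerivAt
  exact hd.unique hu

variable {g : ℝ → SmoothMetric n M}

/-- The function `R(γ_s(τ)) + |∂γ_s/∂τ|²` of `(s, τ)`. -/
def energyDensity (g : ℝ → SmoothMetric n M) (γ : ℝ → ℝ → M) (K : Set ℝ) (q : ℝ × ℝ) : ℝ :=
  scalarCurvature (g q.2) (γ q.1 q.2) +
    (g q.2).inner (γ q.1 q.2) (velocity K (γ q.1) q.2) (velocity K (γ q.1) q.2)

/-- The function `⟨X, Y⟩` of time, for a family of curves with velocity `X` and variation field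
`Y`. -/
def velocityInnerVariation (g : ℝ → SmoothMetric n M) (γ : ℝ → ℝ → M) (K : Set ℝ) (τ : ℝ) : ℝ :=
  (g τ).inner (γ 0 τ) (velocity K (γ 0) τ) (variationField γ τ)

theorem inner_velocity_eq
    (hγ : ContMDiffOn 𝓘(ℝ, ℝ × ℝ) (𝓡 n) ∞ (fun p : ℝ × ℝ => γ p.1 p.2) (S ×ˢ K))
    (hK : UniqueDiffOn ℝ K) {p : M} {q : ℝ × ℝ} (hq : q ∈ S ×ˢ K)
    (hp : γ q.1 q.2 ∈ (extChartAt (𝓡 n) p).source) :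
    (g q.2).inner (γ q.1 q.2) (velocity K (γ q.1) q.2) (velocity K (γ q.1) q.2) =
      flowMetric g p (chartFamily (n := n) γ p q, q.2)
        (fderivWithin ℝ (chartFamily (n := n) γ p) (S ×ˢ K) q (0, 1))
        (fderivWithin ℝ (chartFamily (n := n) γ p) (S ×ˢ K) q (0, 1)) := by
  rw [inner_eq_chartMetric (g q.2) hp, chartDeriv_velocity hγ hK hq.1 hq.2 hp]
  rfl

theorem velocityInnerVariation_eq
    (hγ : ContMDiffOn 𝓘(ℝ, ℝ × ℝ) (𝓡 n) ∞ (fun p : ℝ × ℝ => γ p.1 p.2) (S ×ˢ K))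
    (hS : S ∈ 𝓝 0) (hK : UniqueDiffOn ℝ K) {p : M} {τ : ℝ} (hτ : τ ∈ K)
    (hp : γ 0 τ ∈ (extChartAt (𝓡 n) p).source) :
    velocityInnerVariation g γ K τ = flowMetric g p (chartFamily (n := n) γ p (0, τ), τ)
      (fderivWithin ℝ (chartFamily (n := n) γ p) (S ×ˢ K) (0, τ) (0, 1))
      (fderivWithin ℝ (chartFamily (n := n) γ p) (S ×ˢ K) (0, τ) (1, 0)) := by
  rw [velocityInnerVariation, inner_eq_chartMetric (g τ) hp,
    chartDeriv_velocity hγ hK (mem_of_mem_nhds hS) hτ hp, chartDeriv_variationField hγ hS hτ hp]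
  rfl

theorem contDiffWithinAt_fderivWithin_chartFamily
    (hγ : ContMDiffOn 𝓘(ℝ, ℝ × ℝ) (𝓡 n) ∞ (fun p : ℝ × ℝ => γ p.1 p.2) (S ×ˢ K))
    (hSK : UniqueDiffOn ℝ (S ×ˢ K)) {q : ℝ × ℝ} (hq : q ∈ S ×ˢ K) (v : ℝ × ℝ) :
    ContDiffWithinAt ℝ ∞ (fun r => fderivWithin ℝ (chartFamily (n := n) γ (γ q.1 q.2)) (S ×ˢ K) r v)
      (S ×ˢ K) q :=
  ((contDiffWithinAt_chartFamily hγ hq (mem_extChartAt_source _)).fderivWithin_right hSK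
    (m := ∞) (by simp) hq).clm_apply contDiffWithinAt_const

theorem contDiffWithinAt_flow_comp {F : Type*} [NormedAddCommGroup F] [NormedSpace ℝ F]
    (hγ : ContMDiffOn 𝓘(ℝ, ℝ × ℝ) (𝓡 n) ∞ (fun p : ℝ × ℝ => γ p.1 p.2) (S ×ˢ K))
    {q : ℝ × ℝ} (hq : q ∈ S ×ˢ K) {f : EuclideanSpace ℝ (Fin n) × ℝ → F}
    (hf : ContDiffOn ℝ ∞ f ((extChartAt (𝓡 n) (γ q.1 q.2)).target ×ˢ K)) :
    ContDiffWithinAt ℝ ∞ (fun r : ℝ × ℝ => f (chartFamily (n := n) γ (γ q.1 q.2) r, r.2))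
      (S ×ˢ K) q := by
  have hmem : (chartFamily (n := n) γ (γ q.1 q.2) q, q.2) ∈
      (extChartAt (𝓡 n) (γ q.1 q.2)).target ×ˢ K := ⟨mem_extChartAt_target _, hq.2⟩
  have h := (hf _ hmem).comp q
    (f := fun r : ℝ × ℝ => (chartFamily (n := n) γ (γ q.1 q.2) r, r.2))
    -- The chart need not contain the whole family, so the composition is restricted to where it
    -- does, a neighbourhood of `q` within the domain.
    (s := {r : ℝ × ℝ | γ r.1 r.2 ∈ (extChartAt (𝓡 n) (γ q.1 q.2)).source} ∩ S ×ˢ K)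
    (((contDiffWithinAt_chartFamily hγ hq (mem_extChartAt_source _)).prodMk
      contDiffWithinAt_snd).mono inter_subset_right)
    (fun r hr => ⟨(extChartAt (𝓡 n) (γ q.1 q.2)).map_source hr.1, hr.2.2⟩)
  exact h.mono_of_mem_nhdsWithin
    (inter_mem (eventually_mem_source hγ hq) self_mem_nhdsWithin)

theorem contDiffOn_energyDensity (hg : IsBackwardRicciFlow g K)
    (hγ : ContMDiffOn 𝓘(ℝ, ℝ × ℝ) (𝓡 n) ∞ (fun p : ℝ × ℝ => γ p.1 p.2) (S ×ˢ K))
    (hS : IsOpen S) (hK : UniqueDiffOn ℝ K) :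
    ContDiffOn ℝ ∞ (energyDensity g γ K) (S ×ˢ K) := by
  intro q hq
  have hX := contDiffWithinAt_fderivWithin_chartFamily hγ (hS.uniqueDiffOn.prod hK) hq (0, 1)
  have h := (contDiffWithinAt_flow_comp hγ hq
    (contDiffOn_chartScalarCurvature hg hK (γ q.1 q.2))).add
    (((contDiffWithinAt_flow_comp hγ hq (contDiffOn_flowMetric hg (γ q.1 q.2))).clm_apply
      hX).clm_apply hX)
  refine h.congr_of_eventuallyEq_of_mem ?_ hq
  filter_upwards [eventually_mem_source hγ hq, self_mem_nhdsWithin] with r hr hr'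
  rw [energyDensity, inner_velocity_eq hγ hK hr' hr, scalarCurvature_eq_metricTrace hg hK hr hr'.2]
  rfl

theorem contDiffOn_velocityInnerVariation (hg : IsBackwardRicciFlow g K)
    (hγ : ContMDiffOn 𝓘(ℝ, ℝ × ℝ) (𝓡 n) ∞ (fun p : ℝ × ℝ => γ p.1 p.2) (S ×ˢ K))
    (hS : IsOpen S) (hS0 : (0 : ℝ) ∈ S) (hK : UniqueDiffOn ℝ K) :
    ContDiffOn ℝ ∞ (velocityInnerVariation g γ K) K := by
  intro τ hτ
  have hq : ((0 : ℝ), τ) ∈ S ×ˢ K := ⟨hS0, hτ⟩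
  have hSK := hS.uniqueDiffOn.prod hK
  have hmaps : MapsTo (fun σ : ℝ => ((0 : ℝ), σ)) K (S ×ˢ K) := fun σ hσ => ⟨hS0, hσ⟩
  have hline : ContDiffWithinAt ℝ ∞ (fun σ : ℝ => ((0 : ℝ), σ)) K τ :=
    contDiffWithinAt_const.prodMk contDiffWithinAt_id
  have h := (((contDiffWithinAt_flow_comp hγ hq (contDiffOn_flowMetric hg (γ 0 τ))).clm_apply
    (contDiffWithinAt_fderivWithin_chartFamily hγ hSK hq (0, 1))).clm_apply
    (contDiffWithinAt_fderivWithin_chartFamily hγ hSK hq (1, 0))).comp τ hline hmaps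
  refine h.congr_of_eventuallyEq_of_mem ?_ hτ
  filter_upwards [(hline.continuousWithinAt.tendsto_nhdsWithin hmaps).eventually
    (eventually_mem_source hγ hq), self_mem_nhdsWithin] with σ hσ hσ'
  exact velocityInnerVariation_eq hγ (hS.mem_nhds hS0) hK hσ' hσ

end SmoothMetric

/-! The covariant derivative of the velocity -/

namespace SmoothMetric

variable {n : ℕ} {M : Type*} [TopologicalSpace M] [ChartedSpace (EuclideanSpace ℝ (Fin n)) M]
  [IsManifold (𝓡 n) ∞ M] {γ : ℝ → ℝ → M} {S K : Set ℝ} {g : ℝ → SmoothMetric n M}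

/-- In the chart frozen at `γ s τ` the velocity has components `∂_τ u`; for interior `τ` all
derivatives within the domain are ordinary ones. -/
theorem covDerivAlong_velocity
    (hγ : ContMDiffOn 𝓘(ℝ, ℝ × ℝ) (𝓡 n) ∞ (fun p : ℝ × ℝ => γ p.1 p.2) (S ×ˢ K))
    (hS : IsOpen S) (hK : UniqueDiffOn ℝ K) {s τ : ℝ} (hs : s ∈ S) (hτ : τ ∈ interior K)
    (g : SmoothMetric n M) :
    covDerivAlong g K (γ s) (velocity K (γ s)) τ =
      (fderiv ℝ (fderiv ℝ (chartFamily (n := n) γ (γ s τ))) (s, τ) (0, 1) (0, 1) +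
        WithLp.toLp 2 fun k => ∑ i, ∑ j,
          christoffel g (γ s τ) k i j (extChartAt (𝓡 n) (γ s τ) (γ s τ)) *
          fderiv ℝ (chartFamily (n := n) γ (γ s τ)) (s, τ) (0, 1) i *
          fderiv ℝ (chartFamily (n := n) γ (γ s τ)) (s, τ) (0, 1) j :
        EuclideanSpace ℝ (Fin n)) := by
  set p := γ s τ with hp
  have hτK := interior_subset hτ
  have hmem : (s, τ) ∈ S ×ˢ K := ⟨hs, hτK⟩
  have hD : S ×ˢ K ∈ 𝓝 (s, τ) := prod_mem_nhds (hS.mem_nhds hs) (mem_interior_iff_mem_nhds.1 hτ)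
  have hu : ContDiffAt ℝ ∞ (chartFamily (n := n) γ p) (s, τ) :=
    (contDiffWithinAt_chartFamily hγ hmem (mem_extChartAt_source _)).contDiffAt hD
  have hline : HasDerivAt (fun σ : ℝ => (s, σ)) (0, 1) τ :=
    (hasDerivAt_const τ s).prodMk (hasDerivAt_id τ)
  have hU : HasDerivAt (fun σ => fderiv ℝ (chartFamily (n := n) γ p) (s, σ) (0, 1))
      (fderiv ℝ (fderiv ℝ (chartFamily (n := n) γ p)) (s, τ) (0, 1) (0, 1)) τ := by
    have h := (((hu.fderiv_right (m := ∞) (by simp)).differentiableAt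
      (by simp)).hasFDerivAt.comp_hasDerivAt τ hline).clm_apply
      (hasDerivAt_const τ ((0 : ℝ), (1 : ℝ)))
    simpa using h
  have hspeed : HasDerivAt (fun σ => extChartAt (𝓡 n) p (γ s σ))
      (fderiv ℝ (chartFamily (n := n) γ p) (s, τ) (0, 1)) τ :=
    (hu.differentiableAt (by simp)).hasFDerivAt.comp_hasDerivAt τ hline
  have hev : ∀ᶠ r in 𝓝 (s, τ), γ r.1 r.2 ∈ (extChartAt (𝓡 n) p).source := by
    have h := eventually_mem_source hγ hmem
    rwa [nhdsWithin_eq_nhds.2 hD] at h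
  have hcomp : (fun σ => chartDeriv p (γ s σ) (velocity K (γ s) σ)) =ᶠ[𝓝 τ]
      fun σ => fderiv ℝ (chartFamily (n := n) γ p) (s, σ) (0, 1) := by
    filter_upwards [hline.continuousAt.eventually hev,
      hline.continuousAt.eventually (eventually_mem_nhds_iff.2 hD)] with σ h1 h2
    rw [chartDeriv_velocity hγ hK hs (mem_of_mem_nhds h2).2 h1, fderivWithin_of_mem_nhds h2]
  have h1 := (hU.congr_of_eventuallyEq hcomp).hasDerivWithinAt.derivWithin (hK τ hτK)
  have h2 := hspeed.hasDerivWithinAt.derivWithin (hK τ hτK)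
  change (derivWithin (fun σ => chartDeriv p (γ s σ) (velocity K (γ s) σ)) K τ +
    WithLp.toLp 2 fun k => ∑ i, ∑ j,
      christoffel g p k i j (extChartAt (𝓡 n) p p) *
        (derivWithin (fun σ => extChartAt (𝓡 n) p (γ s σ)) K τ) i *
        (chartDeriv p (γ s τ) (velocity K (γ s) τ)) j : EuclideanSpace ℝ (Fin n)) = _
  rw [h1, h2, show chartDeriv p (γ s τ) (velocity K (γ s) τ) =
    fderiv ℝ (chartFamily (n := n) γ p) (s, τ) (0, 1) from hcomp.eq_of_nhds]

end SmoothMetric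

/-! The pointwise first variation formula -/

namespace SmoothMetric

variable {n : ℕ} {M : Type*} [TopologicalSpace M] [ChartedSpace (EuclideanSpace ℝ (Fin n)) M]
  [IsManifold (𝓡 n) ∞ M] {γ : ℝ → ℝ → M} {S K : Set ℝ} {g : ℝ → SmoothMetric n M}

theorem hasDerivAt_scalarCurvature_family (hg : IsBackwardRicciFlow g K) (hK : UniqueDiffOn ℝ K)
    (hγ : ContMDiffOn 𝓘(ℝ, ℝ × ℝ) (𝓡 n) ∞ (fun p : ℝ × ℝ => γ p.1 p.2) (S ×ˢ K))
    (hS : S ∈ 𝓝 0) {τ : ℝ} (hτ : τ ∈ K) :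
    HasDerivAt (fun s => scalarCurvature (g τ) (γ s τ))
      ((g τ).inner (γ 0 τ) (variationField γ τ)
        (gradient (g τ) (scalarCurvature (g τ)) (γ 0 τ))) 0 := by
  have h := (mdifferentiableAt_scalarCurvature hg hK (γ 0 τ) hτ).hasMFDerivAt.comp 0
    (mdifferentiableAt_family hγ hS hτ).hasMFDerivAt
  let L : ℝ →L[ℝ] ℝ := (mvfderiv (𝓡 n) (scalarCurvature (g τ)) (γ 0 τ)).comp
    (mfderiv 𝓘(ℝ, ℝ) (𝓡 n) (fun s => γ s τ) 0)
  have hL : HasFDerivAt (fun s => scalarCurvature (g τ) (γ s τ)) L 0 :=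
    hasMFDerivAt_iff_hasFDerivAt.1 h
  have hd : HasDerivAt (fun s => scalarCurvature (g τ) (γ s τ)) (L 1) 0 := hL.hasDerivAt
  rw [gradient, inner_sharp]
  exact hd

/-- The pointwise form of the first variation formula. -/
theorem hasDerivAt_energyDensity (hg : IsBackwardRicciFlow g K) (hK : UniqueDiffOn ℝ K)
    (hγ : ContMDiffOn 𝓘(ℝ, ℝ × ℝ) (𝓡 n) ∞ (fun p : ℝ × ℝ => γ p.1 p.2) (S ×ˢ K))
    (hS : IsOpen S) (hS0 : (0 : ℝ) ∈ S) {τ : ℝ} (hτ : τ ∈ interior K) :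
    HasDerivAt (fun s => energyDensity g γ K (s, τ))
      ((g τ).inner (γ 0 τ) (variationField γ τ)
        (gradient (g τ) (scalarCurvature (g τ)) (γ 0 τ)
          - (2 : ℝ) • covDerivAlong (g τ) K (γ 0) (velocity K (γ 0)) τ
          - (4 : ℝ) • ricciVec (g τ) (γ 0 τ) (velocity K (γ 0) τ))
        + 2 * deriv (velocityInnerVariation g γ K) τ) 0 := by
  set p := γ 0 τ with hp
  have hτK := interior_subset hτ
  have hmem : ((0 : ℝ), τ) ∈ S ×ˢ K := ⟨hS0, hτK⟩
  have hS' := hS.mem_nhds hS0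
  have hKn := mem_interior_iff_mem_nhds.1 hτ
  have hD : S ×ˢ K ∈ 𝓝 ((0 : ℝ), τ) := prod_mem_nhds hS' hKn
  have hps : γ 0 τ ∈ (extChartAt (𝓡 n) p).source := mem_extChartAt_source _
  set u := chartFamily (n := n) γ p with hudef
  have hu : ContDiffAt ℝ ∞ u (0, τ) := (contDiffWithinAt_chartFamily hγ hmem hps).contDiffAt hD
  have hev : ∀ᶠ r in 𝓝 ((0 : ℝ), τ), γ r.1 r.2 ∈ (extChartAt (𝓡 n) p).source := by
    have h := eventually_mem_source hγ hmem
    rwa [nhdsWithin_eq_nhds.2 hD] at h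
  have hs : HasDerivAt (fun s : ℝ => (s, τ)) (1, 0) 0 :=
    (hasDerivAt_id 0).prodMk (hasDerivAt_const 0 τ)
  have ht : HasDerivAt (fun σ : ℝ => ((0 : ℝ), σ)) (0, 1) τ :=
    (hasDerivAt_const τ (0 : ℝ)).prodMk (hasDerivAt_id τ)
  have hT : (extChartAt (𝓡 n) p).target ×ˢ K ∈ 𝓝 (u (0, τ), τ) :=
    prod_mem_nhds (extChartAt_target_mem_nhds p) hKn
  set F := flowMetric g p with hFdef
  set F' := fderiv ℝ F (u (0, τ), τ) with hF'def
  have hF : HasFDerivAt F F' (u (0, τ), τ) :=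
    (((contDiffOn_flowMetric hg p).contDiffAt hT).differentiableAt (by simp)).hasFDerivAt
  have hchart : HasFDerivAt (chartMetric (g τ) p) (F'.comp (ContinuousLinearMap.inl ℝ _ ℝ))
      (u (0, τ)) := by
    have h := HasFDerivAt.partial_fst
      (G := EuclideanSpace ℝ (Fin n) →L[ℝ] EuclideanSpace ℝ (Fin n) →L[ℝ] ℝ)
      (F := F) (F' := F') (z := u (0, τ)) (t := τ) hF
    exact h
  -- the density and `⟨X, Y⟩` in the chart at `γ 0 τ`
  have hR := hasDerivAt_scalarCurvature_family hg hK hγ hS' hτK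
  have hXX := hasDerivAt_bilin_fderiv_comp (c := fun s : ℝ => (s, τ)) hu hF hs (0, 1) (0, 1)
  have hXY := hasDerivAt_bilin_fderiv_comp (c := fun σ : ℝ => ((0 : ℝ), σ)) hu hF ht (0, 1) (1, 0)
  have hdens := (hR.add hXX).congr_of_eventuallyEq
    (f₁ := fun s => energyDensity g γ K (s, τ)) (by
      filter_upwards [hs.continuousAt.eventually hev,
        hs.continuousAt.eventually (eventually_mem_nhds_iff.2 hD)] with s h1 h2
      simp only [energyDensity, Pi.add_apply]
      rw [inner_velocity_eq (q := (s, τ)) hγ hK (mem_of_mem_nhds h2) h1,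
        fderivWithin_of_mem_nhds h2])
  have hq := (hXY.congr_of_eventuallyEq
    (f₁ := velocityInnerVariation g γ K) (by
      filter_upwards [ht.continuousAt.eventually hev,
        ht.continuousAt.eventually (eventually_mem_nhds_iff.2 hD)] with σ h1 h2
      rw [velocityInnerVariation_eq hγ hS' hK (mem_of_mem_nhds h2).2 h1,
        fderivWithin_of_mem_nhds h2])).deriv
  refine hdens.congr_deriv ?_
  -- the velocity and the variation field in the chart
  have hX : velocity K (γ 0) τ = (fderiv ℝ u (0, τ) (0, 1) : EuclideanSpace ℝ (Fin n)) := by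
    rw [← chartDeriv_self (γ 0 τ) (velocity K (γ 0) τ)]
    exact (chartDeriv_velocity hγ hK hS0 hτK hps).trans (by rw [fderivWithin_of_mem_nhds hD])
  have hY : variationField γ τ = (fderiv ℝ u (0, τ) (1, 0) : EuclideanSpace ℝ (Fin n)) := by
    rw [← chartDeriv_self (γ 0 τ) (variationField γ τ)]
    exact (chartDeriv_variationField hγ hS' hτK hps).trans (by rw [fderivWithin_of_mem_nhds hD])
  -- Koszul's formula with both lower slots equal to `X`, paired with `Y`.
  have hcov : (g τ).inner p (variationField γ τ)
      (covDerivAlong (g τ) K (γ 0) (velocity K (γ 0)) τ) =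
      F (u (0, τ), τ) (fderiv ℝ u (0, τ) (1, 0)) (fderiv ℝ (fderiv ℝ u) (0, τ) (0, 1) (0, 1)) +
      (1 / 2) * (2 * F' (fderiv ℝ u (0, τ) (0, 1), 0) (fderiv ℝ u (0, τ) (0, 1))
          (fderiv ℝ u (0, τ) (1, 0)) -
        F' (fderiv ℝ u (0, τ) (1, 0), 0) (fderiv ℝ u (0, τ) (0, 1))
          (fderiv ℝ u (0, τ) (0, 1))) := by
    have hk := chartMetric_christoffel (mem_extChartAt_target p) hchart
      (fderiv ℝ u (0, τ) (1, 0)) (fderiv ℝ u (0, τ) (0, 1)) (fderiv ℝ u (0, τ) (0, 1))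
    rw [inner_self_eq_chartMetric, covDerivAlong_velocity hγ hS hK hS0 hτ, hY]
    refine (map_add (chartMetric (g τ) p (u (0, τ)) (fderiv ℝ u (0, τ) (1, 0))) _ _).trans ?_
    congr 1
    refine hk.trans ?_
    simp only [ContinuousLinearMap.comp_apply, ContinuousLinearMap.inl_apply]
    ring
  have hric : (g τ).inner p (variationField γ τ) (ricciVec (g τ) p (velocity K (γ 0) τ)) =
      (1 / 2) * F' (0, 1) (fderiv ℝ u (0, τ) (0, 1)) (fderiv ℝ u (0, τ) (1, 0)) := by
    have h1 := hg.flow τ hτK p (velocity K (γ 0) τ) (variationField γ τ)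
    have h2 := (hF.hasDerivAt_bilin (c := fun σ => (u (0, τ), σ))
      ((hasDerivAt_const τ (u (0, τ))).prodMk (hasDerivAt_id τ)) rfl
      (hasDerivAt_const τ (fderiv ℝ u (0, τ) (0, 1)))
      (hasDerivAt_const τ (fderiv ℝ u (0, τ) (1, 0)))).hasDerivWithinAt (s := K)
    have h3 : (fun σ => (g σ).inner p (velocity K (γ 0) τ) (variationField γ τ)) =
        fun σ => F (u (0, τ), σ) (fderiv ℝ u (0, τ) (0, 1)) (fderiv ℝ u (0, τ) (1, 0)) := by
      funext σ
      rw [inner_self_eq_chartMetric, hX, hY]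
      rfl
    rw [h3] at h1
    have h4 := (hK τ hτK).eq_deriv _ h2 h1
    rw [ricciVec, inner_sharp]
    simp only [map_zero, zero_apply, add_zero] at h4
    rw [h4]
    ring
  have hsymm : fderiv ℝ (fderiv ℝ u) (0, τ) (1, 0) (0, 1) =
      fderiv ℝ (fderiv ℝ u) (0, τ) (0, 1) (1, 0) :=
    hu.isSymmSndFDerivAt (by simpa using! WithTop.coe_le_coe.2 (le_top : (2 : ℕ∞) ≤ ⊤)) _ _
  have hFsymm : ∀ a b, F (u (0, τ), τ) a b = F (u (0, τ), τ) b a :=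
    chartMetric_symm (g τ) p (u (0, τ))
  -- Along the curve the metric varies through position and through time: the first part goes to the
  -- Koszul terms, the second to the Ricci term.
  have hsplit : F' (fderiv ℝ u (0, τ) (0, 1), 1) =
      F' (fderiv ℝ u (0, τ) (0, 1), 0) + F' (0, 1) := by
    rw [← map_add]; simp
  simp only [map_sub, map_smul, smul_eq_mul]
  rw [hcov, hric, hq, hsymm, hsplit, hFsymm (fderiv ℝ u (0, τ) (1, 0)),
    hFsymm (fderiv ℝ (fderiv ℝ u) (0, τ) (0, 1) (1, 0))]
  simp only [add_apply]
  ring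

end SmoothMetric

end

/-! ### Integration of the pointwise formula -/

theorem theorem2p1 {n : ℕ} {M : Type*} [TopologicalSpace M]
    [ChartedSpace (EuclideanSpace ℝ (Fin n)) M] [IsManifold (𝓡 n) ∞ M]
    (J : Set ℝ) (hJ : J.OrdConnected)
    (g : ℝ → SmoothMetric n M) (hg : IsBackwardRicciFlow g J)
    (τ₁ τ₂ : ℝ) (hτ₁ : 0 ≤ τ₁) (hτ : τ₁ < τ₂) (hτJ : Icc τ₁ τ₂ ⊆ J)
    (ε : ℝ) (hε : 0 < ε) (γ : ℝ → ℝ → M)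
    (hγ : ContMDiffOn 𝓘(ℝ, ℝ × ℝ) (𝓡 n) ∞ (fun p : ℝ × ℝ => γ p.1 p.2)
      (Ioo (-ε) ε ×ˢ Icc τ₁ τ₂)) :
    let X : ∀ τ, TangentSpace (𝓡 n) (γ 0 τ) := SmoothMetric.velocity (Icc τ₁ τ₂) (γ 0)
    let Y : ∀ τ, TangentSpace (𝓡 n) (γ 0 τ) := variationField γ
    (∀ s ∈ Ioo (-ε) ε, IntervalIntegrable (LIntegrand g τ₁ τ₂ (γ s)) volume τ₁ τ₂) ∧
    IntervalIntegrable (fun τ =>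
      √τ * (g τ).inner (γ 0 τ) (Y τ) (eulerLagrangeField g τ₁ τ₂ (γ 0) τ)) volume τ₁ τ₂ ∧
    HasDerivAt (fun s => LLength g τ₁ τ₂ (γ s))
      ((2 * √τ₂ * (g τ₂).inner (γ 0 τ₂) (X τ₂) (Y τ₂)
          - 2 * √τ₁ * (g τ₁).inner (γ 0 τ₁) (X τ₁) (Y τ₁))
        + ∫ τ in τ₁..τ₂,
          √τ * (g τ).inner (γ 0 τ) (Y τ) (eulerLagrangeField g τ₁ τ₂ (γ 0) τ)) 0 := by
  intro X Y
  set K := Icc τ₁ τ₂ with hKdef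
  have hK : UniqueDiffOn ℝ K := uniqueDiffOn_Icc hτ
  -- Velocities are taken within `[τ₁, τ₂]`, so the flow is restricted to the same interval, where
  -- one-sided derivatives are unique.
  have hgK : IsBackwardRicciFlow g K :=
    ⟨hg.smooth.mono (prod_mono_right hτJ), fun τ hτ x v w => (hg.flow τ (hτJ hτ) x v w).mono hτJ⟩
  have h0 : (0 : ℝ) ∈ Ioo (-ε) ε := ⟨by linarith, hε⟩
  have hH : ContDiffOn ℝ ∞ (SmoothMetric.energyDensity g γ K) (Ioo (-ε) ε ×ˢ K) :=
    SmoothMetric.contDiffOn_energyDensity hgK hγ isOpen_Ioo hK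
  have hq : ContDiffOn ℝ ∞ (SmoothMetric.velocityInnerVariation g γ K) K :=
    SmoothMetric.contDiffOn_velocityInnerVariation hgK hγ isOpen_Ioo h0 hK
  obtain ⟨hint, hderiv⟩ := hasDerivAt_integral_weight_mul hτ hε Real.continuous_sqrt hH
  obtain ⟨hint', hFTC⟩ := integral_deriv_sqrt_mul hτ₁ hτ hq
  have hpt : EqOn (fun τ => √τ * deriv (fun s => SmoothMetric.energyDensity g γ K (s, τ)) 0
      - √τ * (1 / τ * SmoothMetric.velocityInnerVariation g γ K τ
        + 2 * deriv (SmoothMetric.velocityInnerVariation g γ K) τ))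
      (fun τ => √τ * (g τ).inner (γ 0 τ) (Y τ) (eulerLagrangeField g τ₁ τ₂ (γ 0) τ))
      (Ioo τ₁ τ₂) := by
    intro τ hτ'
    have hint : τ ∈ interior K := by rwa [hKdef, interior_Icc]
    have h := (SmoothMetric.hasDerivAt_energyDensity hgK hK hγ isOpen_Ioo h0 hint).deriv
    simp only [h, eulerLagrangeField, ← hKdef]
    -- Only the `X / τ` term is split off; it matches the `q / τ` produced by integrating by parts.
    rw [map_sub _ _ ((1 / τ) • _), map_smul, SmoothMetric.velocityInnerVariation,
      (g τ).symm _ _ (variationField γ τ), smul_eq_mul]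
    ring
  refine ⟨fun s hs => intervalIntegrable_weight_mul_slice hτ.le Real.continuous_sqrt hH hs,
    (hint.sub hint').congr_uIoo (by rwa [uIoo_of_le hτ.le]), ?_⟩
  have hval := intervalIntegral.integral_congr_Ioo_of_le (μ := volume) hτ.le hpt
  rw [intervalIntegral.integral_sub hint hint', hFTC] at hval
  refine hderiv.congr_deriv ?_
  rw [← hval]
  simp only [SmoothMetric.velocityInnerVariation]
  ring
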